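/- Let $S^2\subset\mathbb R^3$ be the unit sphere with poles $(0,0,\pm1)$; a longitude is an open great semicircle joining the poles. Let $G$ be a simple graph with $n\ge 4$ vertices. A shortest-path drawing of $G$ on $S^2$ draws every edge as a great-circular arc of length less than $\pi$; it is an embedding if it is injective. A (generic shortest-path) triangulation is a shortest-path embedding $\Gamma$ of $G$ such that every face (component of the complement) is bounded by a cycle of three distinct edges, no great circle contains more than two vertices, and no great circle through the poles contains more than one vertex. (So $G$ is maximal planar.) A face is non-polar if it contains neither pole. A drawing is southern if every vertex lies strictly below the equator $z=0$. For corners $(i,j,k)$ of a face of $\Gamma$, the sign of $\det(p_i,p_j,p_k)$ of the vertex positions in a drawing is its orientation there; the face is degenerate there if this determinant is $0$. Two triangulations of $G$ are $\theta$-equivalent if they define the same rotation system and every vertex lies on the same longitude in both. A longitudinal morph from $\Gamma$ to $\Gamma'$ is a continuous map $H:[0,1]\times G\to S^2$ with $H(0,\cdot)=\Gamma$ and $H(1,\cdot)=\Gamma'$ such that every $H(t,\cdot)$ is a shortest-path embedding and every vertex stays on its longitude. $\Gamma$ is sinkable if there is a longitudinal morph from $\Gamma$ to a $\theta$-equivalent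 southern triangulation. A weak triangulation (relative to the faces of $\Gamma$) is a shortest-path drawing $\Gamma'$ of $G$ that may have degenerate faces, but has no crossing edges (two edges whose interiors meet lie on a common great circle) and no inverted faces (with corners listed counterclockwise around each face of $\Gamma$, the determinant in $\Gamma'$ is non-negative for all faces except at most one, which may be everted, i.e. drawn as the complement of the small triangle with its corners). It is $\theta$-equivalent to $\Gamma$ if every vertex lies on the same longitude in $\Gamma$ and $\Gamma'$, and every non-polar face of $\Gamma$ that is non-degenerate in $\Gamma'$ has the same orientation in $\Gamma'$ as in $\Gamma$. **Corollary.** A triangulation $\Gamma$ is sinkable if and only if there is a southern weak triangulation that is $\theta$-equivalent to $\Gamma$. -/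

import Mathlib

open Set Filter Topology

namespace SphereDrawing

/-! ## The sphere -/

/-- Euclidean 3-space. -/
abbrev E3 : Type := EuclideanSpace ℝ (Fin 3)

/-- The unit sphere; coordinates of `x : S2` are `x.1 0`, `x.1 1`, `x.1 2`. -/
abbrev S2 : Type := Metric.sphere (0 : E3) 1

/-- The north pole `(0,0,1)`. -/
noncomputable def northPole : S2 := ⟨EuclideanSpace.single 2 1, by simp⟩

/-- The south pole `(0,0,-1)`. -/
noncomputable def southPole : S2 := -northPole

/-- The longitude at angle `φ`: the open great semicircle between the two poles through
`(cos φ, sin φ, 0)`. -/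
def longitude (φ : ℝ) : Set S2 :=
  {x | ∃ r : ℝ, 0 < r ∧ x.1 0 = r * Real.cos φ ∧ x.1 1 = r * Real.sin φ}

/-- The two points lie on a common longitude (in particular neither is a pole). -/
def SameLongitude (x y : S2) : Prop := ∃ φ : ℝ, x ∈ longitude φ ∧ y ∈ longitude φ

/-- The determinant with rows `a`, `b`, `c`. For points of the sphere it vanishes iff they lie on a
common great circle, and it is positive iff `c` is strictly to the left of the directed
great circle from `a` to `b`, seen from outside the sphere. -/
def orient (a b c : E3) : ℝ :=
  Matrix.det !![a 0, a 1, a 2; b 0, b 1, b 2; c 0, c 1, c 2]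

/-- The shortest great-circular arc from `a` to `b` (used for `a ≠ -b`), with its endpoints. -/
def arc (a b : S2) : Set S2 :=
  {x | ∃ s t : ℝ, 0 ≤ s ∧ 0 ≤ t ∧ x.1 = s • a.1 + t • b.1}

/-- The same arc without its endpoints. -/
def openArc (a b : S2) : Set S2 :=
  {x | ∃ s t : ℝ, 0 < s ∧ 0 < t ∧ x.1 = s • a.1 + t • b.1}

/-! ## Graphs as topological spaces, and their drawings -/

variable {n : ℕ}

/-- The geometric realization of `G` as a one-dimensional complex, in barycentric coordinates:
convex combinations of the vertices supported on a single vertex or on a single edge. -/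
abbrev Realization (G : SimpleGraph (Fin n)) : Type :=
  {w : Fin n → ℝ // w ∈ stdSimplex ℝ (Fin n) ∧
    ∃ u v : Fin n, (u = v ∨ G.Adj u v) ∧ ∀ x, w x ≠ 0 → x = u ∨ x = v}

/-- The vertex `v` as a point of the realization. -/
def vertex (G : SimpleGraph (Fin n)) (v : Fin n) : Realization G :=
  ⟨Pi.single v 1, single_mem_stdSimplex ℝ v, v, v, Or.inl rfl, fun x hx => by
    by_contra h
    exact hx (Pi.single_eq_of_ne (fun e => h (Or.inl e)) 1)⟩

/-- The closed edge between the adjacent vertices `u` and `v`. -/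
def edge (G : SimpleGraph (Fin n)) (u v : Fin n) : Set (Realization G) :=
  {w | ∀ x, w.1 x ≠ 0 → x = u ∨ x = v}

variable {G : SimpleGraph (Fin n)}

/-- The position of the vertex `v` in the drawing `Γ`. -/
def pos (Γ : Realization G → S2) (v : Fin n) : S2 := Γ (vertex G v)

/-- A drawing of `G` in which every edge is drawn as a great-circular arc of length less
than `π`. Different edges may meet. -/
structure IsShortestPathDrawing (Γ : Realization G → S2) : Prop where
  continuous : Continuous Γ
  not_antipodal : ∀ u v, G.Adj u v → pos Γ u ≠ -pos Γ v
  simple_edge : ∀ u v, G.Adj u v → InjOn Γ (edge G u v)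
  edge_eq_arc : ∀ u v, G.Adj u v → Γ '' edge G u v = arc (pos Γ u) (pos Γ v)

/-- An embedding of `G` whose edges are shortest paths. -/
structure IsShortestPathEmbedding (Γ : Realization G → S2) : Prop
    extends IsShortestPathDrawing Γ where
  injective : Function.Injective Γ

/-! ## Faces -/

/-- `U` is a face of `Γ`: a connected component of the complement of the drawing. -/
def IsFace (Γ : Realization G → S2) (U : Set S2) : Prop :=
  ∃ x ∈ (range Γ)ᶜ, U = connectedComponentIn (range Γ)ᶜ x

/-- The boundary of `U` is the cycle formed by the three edges `ij`, `jk`, `ki` of `G`. -/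
def BoundedBy (Γ : Realization G → S2) (U : Set S2) (i j k : Fin n) : Prop :=
  G.Adj i j ∧ G.Adj j k ∧ G.Adj k i ∧
    frontier U = Γ '' edge G i j ∪ Γ '' edge G j k ∪ Γ '' edge G k i

/-- `U` lies immediately to the left of the edge directed from `i` to `j`. -/
def IsLeftOf (Γ : Realization G → S2) (U : Set S2) (i j : Fin n) : Prop :=
  ∀ m ∈ openArc (pos Γ i) (pos Γ j),
    ∀ᶠ x : S2 in 𝓝 m, 0 < orient (pos Γ i).1 (pos Γ j).1 x.1 → x ∈ U

/-- `(i,j,k)` is a face of `Γ`, listed counterclockwise around its interior `U`. -/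
def IsCcwFace (Γ : Realization G → S2) (U : Set S2) (i j k : Fin n) : Prop :=
  IsFace Γ U ∧ BoundedBy Γ U i j k ∧ IsLeftOf Γ U i j ∧ IsLeftOf Γ U j k ∧ IsLeftOf Γ U k i

/-- The region `U` contains neither pole. -/
def IsNonPolar (U : Set S2) : Prop := northPole ∉ U ∧ southPole ∉ U

/-! ## Triangulations -/

/-- A generic shortest-path triangulation of the sphere. -/
structure IsTriangulation (Γ : Realization G → S2) : Prop
    extends IsShortestPathEmbedding Γ where
  /-- every face is bounded by a cycle of three distinct edges -/
  faces : ∀ U, IsFace Γ U → ∃ i j k, BoundedBy Γ U i j k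
  /-- no great circle contains more than two vertices -/
  generic : ∀ u v w, u ≠ v → v ≠ w → u ≠ w →
    orient (pos Γ u).1 (pos Γ v).1 (pos Γ w).1 ≠ 0
  /-- no great circle through the poles contains more than one vertex -/
  generic_poles : ∀ u v, u ≠ v → orient northPole.1 (pos Γ u).1 (pos Γ v).1 ≠ 0

/-- Every vertex lies below the equator. -/
def IsSouthern (Γ : Realization G → S2) : Prop := ∀ v, (pos Γ v).1 2 < 0

/-- The unit tangent vector at `u` of the great-circular arc that leaves `u` towards `a`. -/
noncomputable def direction (u a : S2) : E3 :=
  (‖a.1 - inner ℝ u.1 a.1 • u.1‖)⁻¹ • (a.1 - inner ℝ u.1 a.1 • u.1)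

/-- The arcs from `u` to `a`, `b`, `c` leave `u` in this counterclockwise cyclic order: their three
unit directions form a counterclockwise triangle in the tangent plane at `u`. -/
def IsCcwAround (u a b c : S2) : Prop :=
  0 < orient u.1 (direction u b - direction u a) (direction u c - direction u a)

/-- Two shortest-path embeddings are isomorphic: they define the same rotation system, that is,
the same counterclockwise cyclic order of the neighbours around every vertex. -/
def Isomorphic (Γ Γ' : Realization G → S2) : Prop :=
  ∀ u a b c, G.Adj u a → G.Adj u b → G.Adj u c →
    (IsCcwAround (pos Γ u) (pos Γ a) (pos Γ b) (pos Γ c) ↔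
      IsCcwAround (pos Γ' u) (pos Γ' a) (pos Γ' b) (pos Γ' c))

/-- `θ`-equivalence of triangulations. -/
def ThetaEquivalent (Γ Γ' : Realization G → S2) : Prop :=
  Isomorphic Γ Γ' ∧ ∀ v, SameLongitude (pos Γ v) (pos Γ' v)

/-! ## Morphs and sinkability -/

/-- `H` is a morph from `Γ` to `Γ'`: an isotopy through shortest-path embeddings. -/
structure IsMorph (H : unitInterval × Realization G → S2) (Γ Γ' : Realization G → S2) :
    Prop where
  continuous : Continuous H
  source : ∀ w, H (0, w) = Γ w
  target : ∀ w, H (1, w) = Γ' w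
  embedding : ∀ t, IsShortestPathEmbedding (fun w => H (t, w))

/-- A morph in which the vertices move only along their longitudes. -/
structure IsLongitudinalMorph (H : unitInterval × Realization G → S2)
    (Γ Γ' : Realization G → S2) : Prop extends IsMorph H Γ Γ' where
  same_longitude : ∀ t v, SameLongitude (pos Γ v) (H (t, vertex G v))

/-- `Γ` can be longitudinally morphed to a `θ`-equivalent triangulation with all vertices below
the equator. -/
def Sinkable (Γ : Realization G → S2) : Prop :=
  ∃ Γ' : Realization G → S2, IsTriangulation Γ' ∧ ThetaEquivalent Γ Γ' ∧ IsSouthern Γ' ∧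
    ∃ H, IsLongitudinalMorph H Γ Γ'

/-! ## Weak triangulations -/

/-- No two edges cross: whenever two open edges meet, they lie on one great circle. -/
def NoCrossingEdges (Γ' : Realization G → S2) : Prop :=
  ∀ u v x y, G.Adj u v → G.Adj x y →
    (openArc (pos Γ' u) (pos Γ' v) ∩ openArc (pos Γ' x) (pos Γ' y)).Nonempty →
    orient (pos Γ' u).1 (pos Γ' v).1 (pos Γ' x).1 = 0 ∧
      orient (pos Γ' u).1 (pos Γ' v).1 (pos Γ' y).1 = 0

/-- No face of `G` is inverted in the drawing `Γ'`, where the faces of `G` and their orientations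
are those of the triangulation `Γ` of `G`. A face `(i,j,k)`, listed counterclockwise, is drawn as
the small triangle with these corners when `0 < orient`, is degenerate when `orient = 0`, and when
`orient < 0` it is either inverted or everted, i.e. drawn as the complement of the small triangle.
At most one face of a drawing can be everted. -/
def NoInvertedFaces (Γ Γ' : Realization G → S2) : Prop :=
  ∃ a b c : Fin n, ∀ U i j k, IsCcwFace Γ U i j k → ({i, j, k} : Set (Fin n)) ≠ {a, b, c} →
    0 ≤ orient (pos Γ' i).1 (pos Γ' j).1 (pos Γ' k).1

/-- `Γ'` is a weak triangulation of `G`: a shortest-path drawing that may include degenerate faces,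
but no inverted faces and no crossing edges. -/
structure IsWeakTriangulation (Γ Γ' : Realization G → S2) : Prop
    extends IsShortestPathDrawing Γ' where
  no_inverted_faces : NoInvertedFaces Γ Γ'
  no_crossing_edges : NoCrossingEdges Γ'

/-- `θ`-equivalence of a weak triangulation `Γ'` to the triangulation `Γ`: the vertices lie on the
same longitudes, and every non-polar face that is non-degenerate in `Γ'` has the same orientation
in `Γ'` as in `Γ`. -/
def WeakThetaEquivalent (Γ Γ' : Realization G → S2) : Prop :=
  (∀ v, SameLongitude (pos Γ v) (pos Γ' v)) ∧
    ∀ U i j k, IsFace Γ U → BoundedBy Γ U i j k → IsNonPolar U →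
      orient (pos Γ' i).1 (pos Γ' j).1 (pos Γ' k).1 ≠ 0 →
      SignType.sign (orient (pos Γ' i).1 (pos Γ' j).1 (pos Γ' k).1) =
        SignType.sign (orient (pos Γ i).1 (pos Γ j).1 (pos Γ k).1)

end SphereDrawing

/-! Moving the vertices along their longitudes means, up to rescaling, shifting `pos Γ v` by a
multiple `k v` of the axis through the poles; extend the shift linearly along the edges. Call `k`
admissible if the shift preserves the orientation of every non-polar face. Two points of the drawing
that are consecutive on a longitude lie on a common non-polar face, on which the shift is the
restriction of a linear map that scales the axis by the ratio of the new to the old determinant of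
the corners. Hence an admissible shift preserves the vertical order on every longitude, so the
shifted drawing is again an embedding, with faces bounded by the same triangles.

A `θ`-equivalent southern weak triangulation is reached by a shift `k` along which some faces may
degenerate. The orientations under the shift `t • k` are affine in `t`, so `t • k` is admissible for
`0 ≤ t < 1`. For `t` close to `1` a small generic perturbation of `t • k` is an admissible shift to
a southern triangulation, and scaling it from `0` to `1` is the required longitudinal morph.

Conversely the end of a morph to a southern triangulation is itself a `θ`-equivalent weak
triangulation: a non-polar face cannot degenerate during the morph, because a vertex would land on
the opposite edge, so its orientation is preserved. -/

namespace SphereDrawing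

/-! ## Half-planes through a line and cones in a real vector space -/

section VectorSpace

variable {E : Type*} [AddCommGroup E] [Module ℝ E] {P a b c : E}

/-- `a` and `b` lie in the same half-plane bounded by the line spanned by `P`: up to a positive
factor they differ by a multiple of `P`. For points of the sphere and `P` a pole, this says that
they lie on the same longitude. -/
def SameHalfPlane (P a b : E) : Prop := ∃ ρ δ : ℝ, 0 < ρ ∧ ρ • b = a + δ • P

/-- `b` lies in the same half-plane bounded by the line spanned by `P` as `a`, and strictly
closer to `P`. For points of the sphere and `P` the north pole, `b` lies north of `a` on the same
longitude. -/
def Above (P a b : E) : Prop := ∃ ρ δ : ℝ, 0 < ρ ∧ 0 < δ ∧ ρ • b = a + δ • P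

lemma Above.sameHalfPlane (h : Above P a b) : SameHalfPlane P a b := by
  obtain ⟨ρ, δ, hρ, -, h⟩ := h
  exact ⟨ρ, δ, hρ, h⟩

lemma Above.trans (h : Above P a b) (h' : Above P b c) : Above P a c := by
  obtain ⟨ρ, δ, hρ, hδ, h⟩ := h
  obtain ⟨ρ', δ', hρ', hδ', h'⟩ := h'
  refine ⟨ρ * ρ', δ + ρ * δ', by positivity, by positivity, ?_⟩
  rw [mul_smul, h', smul_add, h]
  module

lemma above_neg_iff : Above (-P) a b ↔ Above P b a := by
  have reverse {P a b : E} : Above P a b → Above (-P) b a := by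
    rintro ⟨ρ, δ, hρ, hδ, h⟩
    refine ⟨ρ⁻¹, ρ⁻¹ * δ, by positivity, by positivity, ?_⟩
    rw [eq_sub_of_add_eq h.symm, smul_sub, inv_smul_smul₀ hρ.ne']
    module
  exact ⟨fun h => by simpa using reverse h, reverse⟩

lemma above_smul_smul_iff {s t : ℝ} (hs : 0 < s) (ht : 0 < t) :
    Above P (s • a) (t • b) ↔ Above P a b := by
  have rescale {a b : E} {s t : ℝ} (hs : 0 < s) (ht : 0 < t) :
      Above P a b → Above P (s • a) (t • b) := by
    rintro ⟨ρ, δ, hρ, hδ, h⟩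
    refine ⟨s * ρ / t, s * δ, by positivity, by positivity, ?_⟩
    rw [smul_smul, div_mul_cancel₀ _ ht.ne', mul_smul, h]
    module
  refine ⟨fun h => ?_, rescale hs ht⟩
  simpa [inv_smul_smul₀, hs.ne', ht.ne'] using rescale (inv_pos.2 hs) (inv_pos.2 ht) h

lemma SameHalfPlane.symm (h : SameHalfPlane P a b) : SameHalfPlane P b a := by
  obtain ⟨ρ, δ, hρ, h⟩ := h
  refine ⟨ρ⁻¹, -(ρ⁻¹ * δ), by positivity, ?_⟩
  rw [eq_sub_of_add_eq h.symm, smul_sub, inv_smul_smul₀ hρ.ne']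
  module

lemma SameHalfPlane.trans (h : SameHalfPlane P a b) (h' : SameHalfPlane P b c) :
    SameHalfPlane P a c := by
  obtain ⟨ρ, δ, hρ, h⟩ := h
  obtain ⟨ρ', δ', hρ', h'⟩ := h'
  refine ⟨ρ * ρ', δ + ρ * δ', by positivity, ?_⟩
  rw [mul_smul, h', smul_add, h]
  module

lemma sameHalfPlane_add_smul (P a : E) (s : ℝ) : SameHalfPlane P a (a + s • P) :=
  ⟨1, s, one_pos, by simp⟩

lemma sameHalfPlane_smul (P a : E) {s : ℝ} (hs : 0 < s) : SameHalfPlane P a (s • a) :=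
  ⟨s⁻¹, 0, by positivity, by simp [inv_smul_smul₀ hs.ne']⟩

lemma SameHalfPlane.trichotomy (h : SameHalfPlane P a b) :
    Above P a b ∨ (∃ s : ℝ, 0 < s ∧ s • b = a) ∨ Above P b a := by
  obtain ⟨ρ, δ, hρ, e⟩ := h
  rcases lt_trichotomy δ 0 with hδ | rfl | hδ
  · exact Or.inr (Or.inr (above_neg_iff.1 ⟨ρ, -δ, hρ, by linarith, by rw [e]; module⟩))
  · exact Or.inr (Or.inl ⟨ρ, hρ, by simpa using e⟩)
  · exact Or.inl ⟨ρ, δ, hρ, hδ, e⟩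

/-- The cone of all combinations of three vectors with positive coefficients. It is open if they
form a basis of `E`. -/
def openCone (a b c : E) : ConvexCone ℝ E where
  carrier := {x | ∃ s t u : ℝ, 0 < s ∧ 0 < t ∧ 0 < u ∧ x = s • a + t • b + u • c}
  smul_mem' := by
    rintro r hr _ ⟨s, t, u, hs, ht, hu, rfl⟩
    exact ⟨r * s, r * t, r * u, by positivity, by positivity, by positivity, by module⟩
  add_mem' := by
    rintro _ ⟨s, t, u, hs, ht, hu, rfl⟩ _ ⟨s', t', u', hs', ht', hu', rfl⟩
    exact ⟨s + s', t + t', u + u', by positivity, by positivity, by positivity, by module⟩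

/-- The cone of all combinations of three vectors with nonnegative coefficients. -/
def closedCone (a b c : E) : ConvexCone ℝ E where
  carrier := {x | ∃ s t u : ℝ, 0 ≤ s ∧ 0 ≤ t ∧ 0 ≤ u ∧ x = s • a + t • b + u • c}
  smul_mem' := by
    rintro r hr _ ⟨s, t, u, hs, ht, hu, rfl⟩
    exact ⟨r * s, r * t, r * u, by positivity, by positivity, by positivity, by module⟩
  add_mem' := by
    rintro _ ⟨s, t, u, hs, ht, hu, rfl⟩ _ ⟨s', t', u', hs', ht', hu', rfl⟩
    exact ⟨s + s', t + t', u + u', by positivity, by positivity, by positivity, by module⟩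

lemma openCone_le_closedCone : openCone a b c ≤ closedCone a b c := by
  rintro x ⟨s, t, u, hs, ht, hu, rfl⟩
  exact ⟨s, t, u, hs.le, ht.le, hu.le, rfl⟩

lemma add_mem_openCone {x y : E} (hx : x ∈ openCone a b c) (hy : y ∈ closedCone a b c) :
    x + y ∈ openCone a b c := by
  obtain ⟨s, t, u, hs, ht, hu, rfl⟩ := hx
  obtain ⟨s', t', u', hs', ht', hu', rfl⟩ := hy
  exact ⟨s + s', t + t', u + u', by positivity, by positivity, by positivity, by module⟩

lemma zero_mem_closedCone : (0 : E) ∈ closedCone a b c :=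
  ⟨0, 0, 0, le_rfl, le_rfl, le_rfl, by simp⟩

lemma sum_mem_openCone : a + b + c ∈ openCone a b c :=
  ⟨1, 1, 1, one_pos, one_pos, one_pos, by simp⟩

lemma sub_smul_sum_notMem_closedCone {x : E} (hx : x ∉ openCone a b c) {s : ℝ} (hs : 0 < s) :
    x - s • (a + b + c) ∉ closedCone a b c := fun hc =>
  hx (by simpa using add_mem_openCone ((openCone a b c).smul_mem hs sum_mem_openCone) hc)

lemma mem_closedCone_of_above {x y z : E} (hxy : Above P x y) (hzx : Above P z x)
    (hy : y ∈ closedCone a b c) (hz : z ∈ closedCone a b c) : x ∈ closedCone a b c := by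
  obtain ⟨ρ, δ, hρ, hδ, e⟩ := hxy
  obtain ⟨ρ', δ', hρ', hδ', e'⟩ := hzx
  have hx : (δ' + δ * ρ') • x = (δ' * ρ) • y + δ • z := by
    rw [mul_smul δ', e, add_smul, mul_smul, e']
    module
  refine ((closedCone a b c).smul_mem_iff (show 0 < δ' + δ * ρ' by positivity)).1 ?_
  rw [hx]
  exact (closedCone a b c).add_mem ((closedCone a b c).smul_mem (by positivity) hy)
    ((closedCone a b c).smul_mem hδ hz)

lemma notMem_openCone_of_above {x y : E} (h : Above P x y) (hx : x ∈ closedCone a b c)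
    (hy : y ∉ openCone a b c) : P ∉ openCone a b c := by
  obtain ⟨ρ, δ, hρ, hδ, e⟩ := h
  refine fun hP => hy (((openCone a b c).smul_mem_iff hρ).1 ?_)
  rw [e, add_comm]
  exact add_mem_openCone ((openCone a b c).smul_mem hδ hP) hx

end VectorSpace

/-! ## Orientation -/

lemma orient_eq (a b c : E3) : orient a b c =
    a 0 * (b 1 * c 2 - b 2 * c 1) - a 1 * (b 0 * c 2 - b 2 * c 0)
      + a 2 * (b 0 * c 1 - b 1 * c 0) := by
  simp only [orient, Matrix.det_fin_three, Matrix.of_apply, Matrix.cons_val]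
  ring

lemma orient_cycle (a b c : E3) : orient a b c = orient b c a := by
  simp only [orient_eq]; ring

lemma orient_add_left (a a' b c : E3) :
    orient (a + a') b c = orient a b c + orient a' b c := by
  simp only [orient_eq, PiLp.add_apply]; ring

lemma orient_smul_left (s : ℝ) (a b c : E3) : orient (s • a) b c = s * orient a b c := by
  simp only [orient_eq, PiLp.smul_apply, smul_eq_mul]; ring

lemma orient_neg_left (a b c : E3) : orient (-a) b c = -orient a b c := by
  rw [← neg_one_smul ℝ a, orient_smul_left, neg_one_mul]

lemma orient_add_mid (a b b' c : E3) :
    orient a (b + b') c = orient a b c + orient a b' c := by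
  simp only [orient_eq, PiLp.add_apply]; ring

lemma orient_smul_mid (s : ℝ) (a b c : E3) : orient a (s • b) c = s * orient a b c := by
  simp only [orient_eq, PiLp.smul_apply, smul_eq_mul]; ring

lemma orient_add_right (a b c c' : E3) :
    orient a b (c + c') = orient a b c + orient a b c' := by
  simp only [orient_eq, PiLp.add_apply]; ring

lemma orient_smul_right (s : ℝ) (a b c : E3) : orient a b (s • c) = s * orient a b c := by
  simp only [orient_eq, PiLp.smul_apply, smul_eq_mul]; ring

@[simp] lemma orient_self_left (a b : E3) : orient a a b = 0 := by
  simp only [orient_eq]; ring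

@[simp] lemma orient_self_right (a b : E3) : orient a b b = 0 := by
  simp only [orient_eq]; ring

@[simp] lemma orient_self_outer (a b : E3) : orient a b a = 0 := by
  simp only [orient_eq]; ring

lemma continuous_orient {X : Type*} [TopologicalSpace X] {f g h : X → E3}
    (hf : Continuous f) (hg : Continuous g) (hh : Continuous h) :
    Continuous fun x => orient (f x) (g x) (h x) := by
  simp only [orient_eq]; fun_prop

/-- Cramer's rule. -/
lemma orient_smul_eq (a b c x : E3) :
    orient a b c • x = orient x b c • a + orient x c a • b + orient x a b • c := by
  ext i
  fin_cases i <;> simp [orient_eq] <;> ring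

section Cone

variable {a b c x : E3} (s t u : ℝ)

lemma orient_comb_left : orient (s • a + t • b + u • c) b c = s * orient a b c := by
  simp [orient_add_left, orient_smul_left]

lemma orient_comb_mid : orient (s • a + t • b + u • c) c a = t * orient a b c := by
  simp [orient_add_left, orient_smul_left, ← orient_cycle a b c]

lemma orient_comb_right : orient (s • a + t • b + u • c) a b = u * orient a b c := by
  simp [orient_add_left, orient_smul_left, orient_cycle c a b]

lemma eq_orient_div_comb (h : orient a b c ≠ 0) (x : E3) :
    x = (orient x b c / orient a b c) • a + (orient x c a / orient a b c) • b +
      (orient x a b / orient a b c) • c := by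
  apply smul_right_injective E3 h
  simp only [smul_add, smul_smul, mul_div_cancel₀ _ h]
  exact orient_smul_eq a b c x

lemma mem_openCone_iff (h : orient a b c ≠ 0) : x ∈ openCone a b c ↔
    0 < orient x b c / orient a b c ∧ 0 < orient x c a / orient a b c ∧
      0 < orient x a b / orient a b c := by
  refine ⟨?_, fun ⟨hs, ht, hu⟩ => ⟨_, _, _, hs, ht, hu, eq_orient_div_comb h x⟩⟩
  rintro ⟨s, t, u, hs, ht, hu, rfl⟩
  simp only [orient_comb_left, orient_comb_mid, orient_comb_right, mul_div_cancel_right₀ _ h]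
  exact ⟨hs, ht, hu⟩

lemma mem_closedCone_iff (h : orient a b c ≠ 0) : x ∈ closedCone a b c ↔
    0 ≤ orient x b c / orient a b c ∧ 0 ≤ orient x c a / orient a b c ∧
      0 ≤ orient x a b / orient a b c := by
  refine ⟨?_, fun ⟨hs, ht, hu⟩ => ⟨_, _, _, hs, ht, hu, eq_orient_div_comb h x⟩⟩
  rintro ⟨s, t, u, hs, ht, hu, rfl⟩
  simp only [orient_comb_left, orient_comb_mid, orient_comb_right, mul_div_cancel_right₀ _ h]
  exact ⟨hs, ht, hu⟩

lemma zero_notMem_openCone (h : orient a b c ≠ 0) : (0 : E3) ∉ openCone a b c := by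
  rw [mem_openCone_iff h]
  simp [orient_eq]

lemma neg_sum_notMem_closedCone (h : orient a b c ≠ 0) : -(a + b + c) ∉ closedCone a b c := by
  simpa using sub_smul_sum_notMem_closedCone (zero_notMem_openCone h) one_pos

end Cone

/-! ## The axis through the poles -/

/-- The unit vector towards the north pole. -/
noncomputable abbrev axis : E3 := EuclideanSpace.single 2 1

lemma orient_axis (a b : E3) : orient axis a b = a 0 * b 1 - a 1 * b 0 := by
  simp [orient_eq]

lemma orient_eq_axis_expansion (a b c : E3) : orient a b c =
    a 2 * orient axis b c + b 2 * orient axis c a + c 2 * orient axis a b := by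
  simp only [orient_axis]
  simp only [orient_eq]
  ring

lemma orient_add_axis (a b c : E3) (x y z : ℝ) :
    orient (a + x • axis) (b + y • axis) (c + z • axis) = orient a b c +
      (x * orient axis b c + y * orient axis c a + z * orient axis a b) := by
  simp only [orient_axis]
  simp [orient_eq]
  ring

/-- The linear map sending `a`, `b`, `c` to their translates along the axis scales the axis by its
determinant. -/
lemma comb_add_axis {a b c : E3} (h : orient a b c ≠ 0) {s t u δ : ℝ}
    (e : s • a + t • b + u • c = δ • axis) (x y z : ℝ) :
    s • (a + x • axis) + t • (b + y • axis) + u • (c + z • axis) =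
      (δ * (orient (a + x • axis) (b + y • axis) (c + z • axis) / orient a b c)) • axis := by
  have hs := orient_comb_left (a := a) (b := b) (c := c) s t u
  have ht := orient_comb_mid (a := a) (b := b) (c := c) s t u
  have hu := orient_comb_right (a := a) (b := b) (c := c) s t u
  rw [e, orient_smul_left] at hs ht hu
  have hδ : δ * (orient (a + x • axis) (b + y • axis) (c + z • axis) / orient a b c) =
      δ + (s * x + t * y + u * z) := by
    rw [orient_add_axis]
    field_simp
    linear_combination x * hs + y * ht + z * hu
  rw [hδ, add_smul, ← e]
  module

lemma smul_eq_add_axis_iff {a b : E3} {ρ δ : ℝ} : ρ • b = a + δ • axis ↔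
    ρ * b 0 = a 0 ∧ ρ * b 1 = a 1 ∧ ρ * b 2 = a 2 + δ := by
  refine ⟨fun h => ?_, fun ⟨h0, h1, h2⟩ => ?_⟩
  · have coord (i : Fin 3) := congrArg (fun x : E3 => x i) h
    simpa using And.intro (coord 0) (And.intro (coord 1) (coord 2))
  · ext i
    fin_cases i <;> simp [h0, h1, h2]

/-- The point does not lie on the line through the poles. -/
def OffAxis (a : E3) : Prop := a 0 ≠ 0 ∨ a 1 ≠ 0

lemma OffAxis.ne_zero {a : E3} (h : OffAxis a) : a ≠ 0 := by
  rintro rfl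
  simp [OffAxis] at h

lemma OffAxis.add_axis {a : E3} (h : OffAxis a) (s : ℝ) : OffAxis (a + s • axis) := by
  simpa [OffAxis] using h

lemma SameHalfPlane.offAxis {a b : E3} (hs : SameHalfPlane axis a b) (ha : OffAxis a) :
    OffAxis b := by
  obtain ⟨ρ, δ, hρ, e⟩ := hs
  obtain ⟨h0, h1, -⟩ := smul_eq_add_axis_iff.1 e
  simpa [OffAxis, ← h0, ← h1, hρ.ne'] using ha

lemma offAxis_of_orient_axis_ne_zero {a b : E3} (h : orient axis a b ≠ 0) : OffAxis a := by
  by_contra hc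
  simp only [OffAxis, not_or, not_not] at hc
  simp [orient_axis, hc.1, hc.2] at h

lemma not_above_self {a : E3} (h : OffAxis a) : ¬ Above axis a a := by
  rintro ⟨ρ, δ, -, hδ, e⟩
  obtain ⟨h0, h1, h2⟩ := smul_eq_add_axis_iff.1 e
  obtain rfl : ρ = 1 := h.elim (fun h => mul_right_cancel₀ h (by linarith))
    (fun h => mul_right_cancel₀ h (by linarith))
  linarith

lemma SameHalfPlane.exists_orient_axis {a a' b b' : E3} (ha : SameHalfPlane axis a a')
    (hb : SameHalfPlane axis b b') :
    ∃ r : ℝ, 0 < r ∧ orient axis a b = r * orient axis a' b' := by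
  obtain ⟨ρ, δ, hρ, e⟩ := ha
  obtain ⟨ρ', δ', hρ', e'⟩ := hb
  obtain ⟨h0, h1, -⟩ := smul_eq_add_axis_iff.1 e
  obtain ⟨h0', h1', -⟩ := smul_eq_add_axis_iff.1 e'
  refine ⟨ρ * ρ', by positivity, ?_⟩
  rw [orient_axis, orient_axis, ← h0, ← h1, ← h0', ← h1']
  ring

namespace S2

lemma norm_coe (x : S2) : ‖x.1‖ = 1 := norm_eq_of_mem_sphere x

lemma eq_one_of_smul_eq {x y : S2} {s : ℝ} (hs : 0 ≤ s) (h : s • x.1 = y.1) : s = 1 := by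
  have hn := congrArg norm h
  rwa [norm_smul, norm_coe, norm_coe, mul_one, Real.norm_of_nonneg hs] at hn

lemma eq_of_smul_eq {x y : S2} {s : ℝ} (hs : 0 ≤ s) (h : s • x.1 = y.1) : x = y :=
  Subtype.ext (by simpa [eq_one_of_smul_eq hs h] using h)

lemma coe_ne_zero (x : S2) : x.1 ≠ 0 := fun h => by
  simpa [h] using x.norm_coe

end S2

/-- `P` is one of the two poles. -/
def IsPole (P : S2) : Prop := P = northPole ∨ P = southPole

lemma northPole_ne_southPole : northPole ≠ southPole := fun h => by
  have h2 : northPole.1 2 = southPole.1 2 := by rw [h]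
  norm_num [northPole, southPole] at h2

lemma coe_northPole : northPole.1 = axis := rfl

lemma coe_southPole : southPole.1 = -axis := rfl

lemma isPole_iff_not_offAxis {x : S2} : IsPole x ↔ ¬ OffAxis x.1 := by
  refine ⟨?_, fun h => ?_⟩
  · rintro (rfl | rfl) <;> simp [OffAxis, coe_northPole, coe_southPole]
  simp only [OffAxis, not_or, not_not] at h
  have e : x.1 = x.1 2 • axis := by
    ext i
    fin_cases i <;> simp [h.1, h.2]
  have hx := x.norm_coe
  rw [e, norm_smul, PiLp.norm_single, norm_one, mul_one, Real.norm_eq_abs] at hx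
  rcases (abs_eq zero_le_one).1 hx with h2 | h2
  · exact Or.inl (Subtype.ext (by rw [e, h2, one_smul, coe_northPole]))
  · exact Or.inr (Subtype.ext (by rw [e, h2, neg_one_smul, coe_southPole]))

lemma SameLongitude.sameHalfPlane {x y : S2} (h : SameLongitude x y) :
    SameHalfPlane axis x.1 y.1 := by
  obtain ⟨φ, ⟨r, hr, h0, h1⟩, ⟨r', hr', h0', h1'⟩⟩ := h
  refine ⟨r / r', r / r' * y.1 2 - x.1 2, by positivity, smul_eq_add_axis_iff.2 ⟨?_, ?_, by ring⟩⟩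
  · rw [h0, h0']; field_simp
  · rw [h1, h1']; field_simp

lemma SameHalfPlane.sameLongitude {x y : S2} (h : SameHalfPlane axis x.1 y.1)
    (hx : OffAxis x.1) : SameLongitude x y := by
  obtain ⟨ρ, δ, hρ, e⟩ := h
  obtain ⟨h0, h1, -⟩ := smul_eq_add_axis_iff.1 e
  let z : ℂ := ⟨x.1 0, x.1 1⟩
  have hz : 0 < ‖z‖ := by
    rw [norm_pos_iff, ne_eq, Complex.ext_iff, not_and_or]
    exact hx
  have hc : x.1 0 = ‖z‖ * Real.cos z.arg := (Complex.norm_mul_cos_arg z).symm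
  have hs : x.1 1 = ‖z‖ * Real.sin z.arg := (Complex.norm_mul_sin_arg z).symm
  refine ⟨z.arg, ⟨‖z‖, hz, hc, hs⟩, ρ⁻¹ * ‖z‖, by positivity, ?_, ?_⟩
  · rw [mul_assoc, ← hc, ← h0]; field_simp
  · rw [mul_assoc, ← hs, ← h1]; field_simp


/-! ## Radial projection -/

/-- The radial projection of space onto the sphere, with junk value `northPole` at the origin. -/
noncomputable def radial (v : E3) : S2 :=
  if h : v = 0 then northPole else ⟨‖v‖⁻¹ • v, by
    have := norm_ne_zero_iff.2 h
    simp [norm_smul, this]⟩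

lemma radial_coe {v : E3} (h : v ≠ 0) : (radial v).1 = ‖v‖⁻¹ • v := by
  simp [radial, h]

lemma exists_radial {v : E3} (h : v ≠ 0) : ∃ s : ℝ, 0 < s ∧ (radial v).1 = s • v :=
  ⟨_, inv_pos.2 (norm_pos_iff.2 h), radial_coe h⟩

lemma radial_eq_of_smul {v : E3} {x : S2} {s : ℝ} (hs : 0 < s) (h : s • x.1 = v) :
    radial v = x := by
  have hv : v ≠ 0 := by
    rw [← h]
    exact smul_ne_zero hs.ne' x.coe_ne_zero
  obtain ⟨t, ht, e⟩ := exists_radial hv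
  refine (S2.eq_of_smul_eq (mul_pos ht hs).le ?_).symm
  rw [e, ← h, smul_smul]

lemma radial_self (x : S2) : radial x.1 = x := radial_eq_of_smul one_pos (one_smul ℝ x.1)

lemma sameHalfPlane_radial (P : E3) {v : E3} (h : v ≠ 0) :
    SameHalfPlane P v (radial v).1 := by
  obtain ⟨s, hs, e⟩ := exists_radial h
  rw [e]
  exact sameHalfPlane_smul P v hs

lemma above_radial_radial_iff {P v w : E3} (hv : v ≠ 0) (hw : w ≠ 0) :
    Above P (radial v).1 (radial w).1 ↔ Above P v w := by
  obtain ⟨s, hs, e⟩ := exists_radial hv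
  obtain ⟨t, ht, e'⟩ := exists_radial hw
  rw [e, e', above_smul_smul_iff hs ht]

lemma mem_arc_radial_radial_iff {v w : E3} (hv : v ≠ 0) (hw : w ≠ 0) {x : S2} :
    x ∈ arc (radial v) (radial w) ↔ ∃ s t : ℝ, 0 ≤ s ∧ 0 ≤ t ∧ x.1 = s • v + t • w := by
  obtain ⟨a, ha, ea⟩ := exists_radial hv
  obtain ⟨b, hb, eb⟩ := exists_radial hw
  rw [arc, mem_ofPred_eq, ea, eb]
  constructor
  · rintro ⟨s, t, hs, ht, e⟩
    exact ⟨s * a, t * b, by positivity, by positivity, by rw [e]; module⟩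
  · rintro ⟨s, t, hs, ht, e⟩
    refine ⟨s * a⁻¹, t * b⁻¹, by positivity, by positivity, ?_⟩
    rw [e, smul_smul, smul_smul, inv_mul_cancel_right₀ ha.ne', inv_mul_cancel_right₀ hb.ne']

lemma continuous_radial {X : Type*} [TopologicalSpace X] {f : X → E3} (hf : Continuous f)
    (h0 : ∀ x, f x ≠ 0) : Continuous fun x => radial (f x) := by
  rw [continuous_induced_rng]
  have h : (Subtype.val ∘ fun x => radial (f x)) = fun x => ‖f x‖⁻¹ • f x :=
    funext fun x => radial_coe (h0 x)
  rw [h]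
  exact (hf.norm.inv₀ fun x => norm_ne_zero_iff.2 (h0 x)).smul hf

lemma isPreconnected_radial_image {C : Set E3} (hC : IsPreconnected C) (h0 : (0 : E3) ∉ C) :
    IsPreconnected (radial '' C) := by
  refine hC.image _ ?_
  rw [continuousOn_iff_continuous_domRestrict]
  exact continuous_radial (f := fun x : C => x.1) continuous_subtype_val
    fun x hx => h0 (hx ▸ x.2)

lemma tendsto_radial_add_smul (x : S2) (v : E3) :
    Tendsto (fun ε : ℝ => radial (x.1 + ε • v)) (𝓝 0) (𝓝 x) := by
  have hc : Continuous fun ε : ℝ => x.1 + ε • v := by fun_prop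
  have hne : ∀ᶠ ε : ℝ in 𝓝 0, x.1 + ε • v ≠ 0 :=
    hc.continuousAt.eventually_ne (by simp [x.coe_ne_zero])
  have hquot : ContinuousAt (fun ε : ℝ => ‖x.1 + ε • v‖⁻¹ • (x.1 + ε • v)) 0 :=
    (hc.norm.continuousAt.inv₀ (by simp)).smul hc.continuousAt
  have hlim := hquot.tendsto
  simp only [zero_smul, add_zero, x.norm_coe, inv_one, one_smul] at hlim
  rw [tendsto_subtype_rng]
  refine hlim.congr' ?_
  filter_upwards [hne] with ε hε
  rw [radial_coe hε]

lemma mem_closure_of_radial {S : Set S2} {x : S2} {v : E3}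
    (h : ∀ ε : ℝ, 0 < ε → x.1 + ε • v ≠ 0 → radial (x.1 + ε • v) ∈ S) : x ∈ closure S := by
  have hc : Continuous fun ε : ℝ => x.1 + ε • v := by fun_prop
  have hne : ∀ᶠ ε : ℝ in 𝓝[>] 0, x.1 + ε • v ≠ 0 :=
    (hc.continuousAt.eventually_ne (by simp [x.coe_ne_zero])).filter_mono nhdsWithin_le_nhds
  have hlim := (tendsto_radial_add_smul x v).mono_left (nhdsWithin_le_nhds (s := Ioi 0))
  refine mem_closure_of_tendsto hlim ?_
  filter_upwards [hne, self_mem_nhdsWithin] with ε h0 hε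
  exact h ε hε h0

/-! ## Frontiers of connected sets -/

lemma exists_mem_frontier_of_isPreconnected {X : Type*} [TopologicalSpace X] {U V : Set X}
    (hV : IsPreconnected V) (h1 : (V ∩ U).Nonempty) (h2 : (V ∩ Uᶜ).Nonempty) :
    (V ∩ frontier U).Nonempty := by
  by_contra hc
  obtain ⟨x, hxV, hxU⟩ := h1
  obtain ⟨y, hyV, hyU⟩ := h2
  have hsub : V ⊆ interior U ∪ (closure U)ᶜ := fun z hz => by
    by_contra hz'
    simp only [mem_union, mem_compl_iff, not_or, not_not] at hz'
    exact hc ⟨z, hz, hz'.2, hz'.1⟩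
  obtain ⟨z, -, hz, hz'⟩ := hV _ _ isOpen_interior isClosed_closure.isOpen_compl hsub
    ⟨x, hxV, (hsub hxV).resolve_right fun h => h (subset_closure hxU)⟩
    ⟨y, hyV, (hsub hyV).resolve_left fun h => hyU (interior_subset h)⟩
  exact hz' (subset_closure (interior_subset hz))

lemma subset_of_disjoint_frontier {X : Type*} [TopologicalSpace X] {U V : Set X}
    (hV : IsPreconnected V) (hd : Disjoint V (frontier U)) (hVU : (V ∩ U).Nonempty) : V ⊆ U := by
  intro y hy
  by_contra hyU
  exact not_disjoint_iff_nonempty_inter.2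
    (exists_mem_frontier_of_isPreconnected hV hVU ⟨y, hy, hyU⟩) hd

lemma zero_notMem_segment {x y : S2} (h : x ≠ -y) : (0 : E3) ∉ segment ℝ x.1 y.1 := by
  rintro ⟨s, t, hs, ht, hst, e⟩
  have e' : s • x.1 = t • (-y).1 := by
    rw [coe_neg_sphere, smul_neg, eq_neg_iff_add_eq_zero, e]
  have hn := congrArg norm e'
  rw [norm_smul, norm_smul, x.norm_coe, (-y).norm_coe, mul_one, mul_one,
    Real.norm_of_nonneg hs, Real.norm_of_nonneg ht] at hn
  subst hn
  exact h (Subtype.ext (smul_right_injective E3 (by linarith : s ≠ 0) e'))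

lemma exists_above_mem_frontier {S : Set S2} {x P : S2} (hxP : x ≠ -P) (hxS : x ∈ S) (hPS : P ∉ S)
    (hxf : x ∉ frontier S) (hPf : P ∉ frontier S) :
    ∃ z ∈ frontier S, Above P.1 x.1 z.1 := by
  have h0 := zero_notMem_segment hxP
  have hpre := isPreconnected_radial_image (convex_segment x.1 P.1).isPreconnected h0
  obtain ⟨_, ⟨_, ⟨s, t, hs, ht, hst, rfl⟩, rfl⟩, hz⟩ := exists_mem_frontier_of_isPreconnected hpre
    ⟨x, ⟨x.1, left_mem_segment ℝ _ _, radial_self x⟩, hxS⟩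
    ⟨P, ⟨P.1, right_mem_segment ℝ _ _, radial_self P⟩, hPS⟩
  have hs' : 0 < s := hs.lt_of_ne <| by
    rintro rfl
    rw [zero_smul, zero_add, radial_eq_of_smul (by linarith : 0 < t) rfl] at hz
    exact hPf hz
  have ht' : 0 < t := ht.lt_of_ne <| by
    rintro rfl
    rw [zero_smul, add_zero, radial_eq_of_smul hs' rfl] at hz
    exact hxf hz
  have hne : s • x.1 + t • P.1 ≠ 0 := fun e => h0 ⟨s, t, hs, ht, hst, e⟩
  refine ⟨_, hz, ?_⟩
  suffices Above P.1 x.1 (s • x.1 + t • P.1) by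
    simpa only [radial_self] using (above_radial_radial_iff x.coe_ne_zero hne).2 this
  refine ⟨s⁻¹, s⁻¹ * t, by positivity, by positivity, ?_⟩
  rw [smul_add, inv_smul_smul₀ hs'.ne', smul_smul]

/-! ## Spherical triangles -/

/-- The open spherical triangle with the given corners, provided that they do not lie on a common
great circle. -/
def openTri (a b c : S2) : Set S2 := {x | x.1 ∈ openCone a.1 b.1 c.1}

/-- The spherical triangle with the given corners, with its boundary. -/
def closedTri (a b c : S2) : Set S2 := {x | x.1 ∈ closedCone a.1 b.1 c.1}

section Triangle

variable {a b c : S2}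

lemma openTri_subset_closedTri : openTri a b c ⊆ closedTri a b c :=
  fun _ hx => openCone_le_closedCone hx

lemma radial_mem_openTri_iff {v : E3} (hv : v ≠ 0) :
    radial v ∈ openTri a b c ↔ v ∈ openCone a.1 b.1 c.1 := by
  obtain ⟨s, hs, e⟩ := exists_radial hv
  change (radial v).1 ∈ openCone a.1 b.1 c.1 ↔ _
  rw [e, (openCone a.1 b.1 c.1).smul_mem_iff hs]

lemma radial_mem_closedTri_iff {v : E3} (hv : v ≠ 0) :
    radial v ∈ closedTri a b c ↔ v ∈ closedCone a.1 b.1 c.1 := by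
  obtain ⟨s, hs, e⟩ := exists_radial hv
  change (radial v).1 ∈ closedCone a.1 b.1 c.1 ↔ _
  rw [e, (closedCone a.1 b.1 c.1).smul_mem_iff hs]

variable (h : orient a.1 b.1 c.1 ≠ 0)
include h

lemma openTri_nonempty : (openTri a b c).Nonempty := by
  have h0 : a.1 + b.1 + c.1 ≠ 0 := fun h0 =>
    zero_notMem_openCone h (by simpa [h0] using sum_mem_openCone (a := a.1) (b := b.1) (c := c.1))
  exact ⟨_, (radial_mem_openTri_iff h0).2 sum_mem_openCone⟩

lemma isOpen_openTri : IsOpen (openTri a b c) := by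
  have hc (p q : E3) : Continuous fun x : S2 => orient x.1 p q / orient a.1 b.1 c.1 :=
    (continuous_orient continuous_subtype_val continuous_const continuous_const).div_const _
  simp only [openTri, mem_openCone_iff h]
  exact (isOpen_lt continuous_const (hc _ _)).and
    ((isOpen_lt continuous_const (hc _ _)).and (isOpen_lt continuous_const (hc _ _)))

lemma isClosed_closedTri : IsClosed (closedTri a b c) := by
  have hc (p q : E3) : Continuous fun x : S2 => orient x.1 p q / orient a.1 b.1 c.1 :=
    (continuous_orient continuous_subtype_val continuous_const continuous_const).div_const _
  simp only [closedTri, mem_closedCone_iff h]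
  exact (isClosed_le continuous_const (hc _ _)).inter
    ((isClosed_le continuous_const (hc _ _)).inter (isClosed_le continuous_const (hc _ _)))

lemma isPreconnected_openTri : IsPreconnected (openTri a b c) := by
  have h0 := zero_notMem_openCone h
  convert isPreconnected_radial_image (openCone a.1 b.1 c.1).convex.isPreconnected h0
  ext x
  refine ⟨fun hx => ⟨x.1, hx, radial_self x⟩, ?_⟩
  rintro ⟨v, hv, rfl⟩
  have hv0 : v ≠ 0 := ne_of_mem_of_not_mem hv h0
  exact (radial_mem_openTri_iff hv0).2 hv

lemma starConvex_compl_closedCone :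
    StarConvex ℝ (-(a.1 + b.1 + c.1)) (closedCone a.1 b.1 c.1 : Set E3)ᶜ := by
  intro x hx s t hs ht hst
  rcases ht.eq_or_lt with rfl | ht
  · obtain rfl : s = 1 := by linarith
    simpa using neg_sum_notMem_closedCone h
  have htx : t • x ∉ closedCone a.1 b.1 c.1 := by
    rwa [(closedCone a.1 b.1 c.1).smul_mem_iff ht]
  rw [smul_neg, add_comm, ← sub_eq_add_neg]
  rcases hs.eq_or_lt with rfl | hs
  · simpa using htx
  · exact sub_smul_sum_notMem_closedCone (fun hc => htx (openCone_le_closedCone hc)) hs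

lemma isPreconnected_compl_closedTri : IsPreconnected (closedTri a b c)ᶜ := by
  have h0 : (0 : E3) ∉ (closedCone a.1 b.1 c.1 : Set E3)ᶜ := fun hc => hc zero_mem_closedCone
  have hpre : IsPreconnected (closedCone a.1 b.1 c.1 : Set E3)ᶜ :=
    ((starConvex_compl_closedCone h).isPathConnected
      (by simpa using neg_sum_notMem_closedCone h)).isConnected.isPreconnected
  convert isPreconnected_radial_image hpre h0
  ext x
  refine ⟨fun hx => ⟨x.1, hx, radial_self x⟩, ?_⟩
  rintro ⟨v, hv, rfl⟩
  have hv0 : v ≠ 0 := ne_of_mem_of_not_mem hv h0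
  rwa [mem_compl_iff, radial_mem_closedTri_iff hv0]

lemma closure_openTri : closure (openTri a b c) = closedTri a b c := by
  refine (closure_minimal openTri_subset_closedTri (isClosed_closedTri h)).antisymm fun x hx => ?_
  refine mem_closure_of_radial (v := a.1 + b.1 + c.1) fun ε hε h0 => ?_
  rw [radial_mem_openTri_iff h0, add_comm]
  exact add_mem_openCone ((openCone a.1 b.1 c.1).smul_mem hε sum_mem_openCone) hx

lemma interior_closedTri : interior (closedTri a b c) = openTri a b c := by
  refine subset_antisymm (fun x hx => ?_)
    (interior_maximal openTri_subset_closedTri (isOpen_openTri h))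
  by_contra hxo
  rw [← compl_compl (interior _), ← closure_compl] at hx
  refine hx (mem_closure_of_radial (v := -(a.1 + b.1 + c.1)) fun ε hε h0 => ?_)
  rw [mem_compl_iff, radial_mem_closedTri_iff h0, smul_neg, ← sub_eq_add_neg]
  exact sub_smul_sum_notMem_closedCone hxo hε

lemma frontier_openTri : frontier (openTri a b c) = closedTri a b c \ openTri a b c := by
  rw [frontier, closure_openTri h, (isOpen_openTri h).interior_eq]

lemma frontier_compl_closedTri :
    frontier (closedTri a b c)ᶜ = closedTri a b c \ openTri a b c := by
  rw [frontier_compl, frontier, (isClosed_closedTri h).closure_eq, interior_closedTri h]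

lemma closedTri_diff_openTri :
    closedTri a b c \ openTri a b c = arc a b ∪ arc b c ∪ arc c a := by
  ext x
  constructor
  · rintro ⟨⟨s, t, u, hs, ht, hu, e⟩, hx⟩
    rcases hs.eq_or_lt with rfl | hs'
    · exact Or.inl (Or.inr ⟨t, u, ht, hu, by simp [e]⟩)
    rcases ht.eq_or_lt with rfl | ht'
    · exact Or.inr ⟨u, s, hu, hs, by simp [e, add_comm]⟩
    rcases hu.eq_or_lt with rfl | hu'
    · exact Or.inl (Or.inl ⟨s, t, hs, ht, by simp [e]⟩)
    exact (hx ⟨s, t, u, hs', ht', hu', e⟩).elim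
  · rintro ((⟨s, t, hs, ht, e⟩ | ⟨s, t, hs, ht, e⟩) | ⟨s, t, hs, ht, e⟩)
    · refine ⟨⟨s, t, 0, hs, ht, le_rfl, by simp [e]⟩, fun hx => ?_⟩
      simpa [e, orient_add_left, orient_smul_left] using ((mem_openCone_iff h).1 hx).2.2
    · refine ⟨⟨0, s, t, le_rfl, hs, ht, by simp [e]⟩, fun hx => ?_⟩
      simpa [e, orient_add_left, orient_smul_left] using ((mem_openCone_iff h).1 hx).1
    · refine ⟨⟨t, 0, s, ht, le_rfl, hs, by simp [e, add_comm]⟩, fun hx => ?_⟩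
      simpa [e, orient_add_left, orient_smul_left] using ((mem_openCone_iff h).1 hx).2.1

lemma eq_openTri_or_eq_compl_closedTri {U : Set S2} (hU : IsPreconnected U) (hne : U.Nonempty)
    (hf : frontier U = closedTri a b c \ openTri a b c) (hd : Disjoint U (frontier U)) :
    U = openTri a b c ∨ U = (closedTri a b c)ᶜ := by
  have hsub : U ⊆ openTri a b c ∨ U ⊆ (closedTri a b c)ᶜ := by
    refine hU.subset_or_subset (isOpen_openTri h) (isClosed_closedTri h).isOpen_compl
      (disjoint_compl_right.mono_left openTri_subset_closedTri) fun x hx => ?_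
    by_contra hc
    simp only [mem_union, mem_compl_iff, not_or, not_not] at hc
    exact hd.notMem_of_mem_left hx (hf ▸ ⟨hc.2, hc.1⟩)
  obtain ⟨x, hx⟩ := hne
  rcases hsub with hs | hs
  · refine Or.inl (hs.antisymm (subset_of_disjoint_frontier (isPreconnected_openTri h) ?_
      ⟨x, hs hx, hx⟩))
    exact hf ▸ disjoint_sdiff_right
  · refine Or.inr (hs.antisymm (subset_of_disjoint_frontier (isPreconnected_compl_closedTri h) ?_
      ⟨x, hs hx, hx⟩))
    exact hf ▸ disjoint_compl_left.mono_right sdiff_subset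

end Triangle

/-! ## Edges of the realization -/

variable {n : ℕ} {G : SimpleGraph (Fin n)}

lemma edge_comm (u v : Fin n) : edge G u v = edge G v u := by
  ext w
  exact forall_congr' fun x => imp_congr_right fun _ => or_comm

lemma vertex_apply_self (v : Fin n) : (vertex G v).1 v = 1 := by simp [vertex]

lemma vertex_apply_of_ne {v x : Fin n} (h : x ≠ v) : (vertex G v).1 x = 0 := by
  simp [vertex, h]

lemma vertex_mem_edge_iff {u v x : Fin n} : vertex G x ∈ edge G u v ↔ x = u ∨ x = v := by
  refine ⟨fun h => h x (by simp [vertex_apply_self]), fun h y hy => ?_⟩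
  obtain rfl : y = x := by
    by_contra hyx
    exact hy (vertex_apply_of_ne hyx)
  exact h

lemma eq_vertex_of_mem_edge_self {v : Fin n} {w : Realization G} (h : w ∈ edge G v v) :
    w = vertex G v := by
  have h0 (x : Fin n) (hx : x ≠ v) : w.1 x = 0 := by
    by_contra hc
    exact hx (by simpa using h x hc)
  have h1 : ∑ x, w.1 x = 1 := w.2.1.2
  rw [Finset.sum_eq_single v (fun x _ hx => h0 x hx) (by simp)] at h1
  ext x
  by_cases hx : x = v
  · rw [hx, h1, vertex_apply_self]
  · rw [h0 x hx, vertex_apply_of_ne hx]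

lemma eq_vertex_of_apply_eq_zero {u v : Fin n} {w : Realization G} (h : w ∈ edge G u v)
    (hu : w.1 u = 0) : w = vertex G v := by
  refine eq_vertex_of_mem_edge_self fun x hx => Or.inr ((h x hx).resolve_left ?_)
  rintro rfl
  exact hx hu

lemma isClosed_edge (u v : Fin n) : IsClosed (edge G u v) := by
  have h : edge G u v = ⋂ x ∈ ({u, v} : Set (Fin n))ᶜ, {w : Realization G | w.1 x = 0} := by
    ext w
    simp only [edge, mem_ofPred_eq, mem_iInter, mem_compl_iff, mem_insert_iff, mem_singleton_iff]
    exact forall_congr' fun x => by tauto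
  rw [h]
  exact isClosed_biInter fun x _ =>
    isClosed_eq ((continuous_apply x).comp continuous_subtype_val) continuous_const

lemma exists_mem_edge (w : Realization G) :
    ∃ u v : Fin n, (u = v ∨ G.Adj u v) ∧ w ∈ edge G u v := w.2.2

/-- The 3-cycle through the vertices `i`, `j`, `l` as a subset of the realization: the boundary of
a face, pulled back by the drawing. -/
def cycle3 (G : SimpleGraph (Fin n)) (i j l : Fin n) : Set (Realization G) :=
  edge G i j ∪ edge G j l ∪ edge G l i

lemma vertex_mem_cycle3_iff {i j l x : Fin n} :
    vertex G x ∈ cycle3 G i j l ↔ x = i ∨ x = j ∨ x = l := by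
  simp only [cycle3, mem_union, vertex_mem_edge_iff]
  tauto

variable {Γ : Realization G → S2}

/-! ## Coefficients along the edges -/

/-- `c` writes `Γ w` as a nonnegative combination of the endpoints of the edge of `w`, or as a
multiple of `Γ w` itself if `w` is a vertex. -/
structure IsCoef (Γ : Realization G → S2) (w : Realization G) (c : Fin n → ℝ) : Prop where
  nonneg : ∀ v, 0 ≤ c v
  eq_zero : ∀ v, w.1 v = 0 → c v = 0
  eq_sum : (Γ w).1 = ∑ v, c v • (pos Γ v).1

/-- Coefficients of `Γ w` with respect to the positions of the vertices, as in `IsCoef`. They exist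
in every shortest-path drawing. -/
noncomputable def coef (Γ : Realization G → S2) (w : Realization G) : Fin n → ℝ :=
  Classical.epsilon (IsCoef Γ w)

/-- The position of the vertex `v`, translated by `k v` along the axis. -/
noncomputable def shift (Γ : Realization G → S2) (k : Fin n → ℝ) (v : Fin n) : E3 :=
  (pos Γ v).1 + k v • axis

/-- The amount by which `Γ w` is translated along the axis when every vertex `v` is translated
by `k v`. -/
noncomputable def rise (Γ : Realization G → S2) (k : Fin n → ℝ) (w : Realization G) : ℝ :=
  ∑ v, coef Γ w v * k v

/-- The point `Γ w` translated along the axis, linearly along each edge. -/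
noncomputable def lift (Γ : Realization G → S2) (k : Fin n → ℝ) (w : Realization G) : E3 :=
  (Γ w).1 + rise Γ k w • axis

lemma isCoef_vertex (Γ : Realization G → S2) (v : Fin n) :
    IsCoef Γ (vertex G v) (Pi.single v 1) where
  nonneg := fun x => (Pi.single_nonneg.2 zero_le_one : (0 : Fin n → ℝ) ≤ Pi.single v 1) x
  eq_zero _ hx := hx
  eq_sum := by simp [Pi.single_apply, pos]

lemma sameHalfPlane_lift (k : Fin n → ℝ) (w : Realization G) :
    SameHalfPlane axis (Γ w).1 (lift Γ k w) := sameHalfPlane_add_smul _ _ _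

namespace IsShortestPathDrawing

variable (h : IsShortestPathDrawing Γ)
include h

lemma exists_isCoef (w : Realization G) : ∃ c, IsCoef Γ w c := by
  obtain ⟨u, v, huv, hw⟩ := exists_mem_edge w
  rcases huv with rfl | huv
  · exact ⟨_, eq_vertex_of_mem_edge_self hw ▸ isCoef_vertex Γ u⟩
  by_cases hu : w.1 u = 0
  · exact ⟨_, eq_vertex_of_apply_eq_zero hw hu ▸ isCoef_vertex Γ v⟩
  by_cases hv : w.1 v = 0
  · exact ⟨_, eq_vertex_of_apply_eq_zero (by rwa [edge_comm]) hv ▸ isCoef_vertex Γ u⟩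
  obtain ⟨s, t, hs, ht, e⟩ : Γ w ∈ arc (pos Γ u) (pos Γ v) :=
    h.edge_eq_arc u v huv ▸ mem_image_of_mem Γ hw
  have hst : (0 : Fin n → ℝ) ≤ Pi.single u s + Pi.single v t :=
    add_nonneg (Pi.single_nonneg.2 hs) (Pi.single_nonneg.2 ht)
  refine ⟨Pi.single u s + Pi.single v t, hst, fun x hx => ?_, ?_⟩
  · have hxu : x ≠ u := fun hc => hu (hc ▸ hx)
    have hxv : x ≠ v := fun hc => hv (hc ▸ hx)
    simp [hxu, hxv]
  · simp [e, Pi.single_apply, add_smul, Finset.sum_add_distrib]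

lemma isCoef (w : Realization G) : IsCoef Γ w (coef Γ w) :=
  Classical.epsilon_spec (h.exists_isCoef w)

lemma coef_eq_zero {w : Realization G} {u v x : Fin n} (hw : w ∈ edge G u v) (hu : x ≠ u)
    (hv : x ≠ v) : coef Γ w x = 0 := by
  refine (h.isCoef w).eq_zero x ?_
  by_contra hc
  exact (hw x hc).elim hu hv

lemma coef_vertex (v : Fin n) : coef Γ (vertex G v) = Pi.single v 1 := by
  have h0 (x : Fin n) (hx : x ≠ v) : coef Γ (vertex G v) x = 0 :=
    (h.isCoef _).eq_zero x (vertex_apply_of_ne hx)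
  have e : (pos Γ v).1 = _ := (h.isCoef (vertex G v)).eq_sum
  rw [Finset.sum_eq_single v (fun x _ hx => by rw [h0 x hx, zero_smul]) (by simp)] at e
  ext x
  by_cases hx : x = v
  · rw [hx, Pi.single_eq_same, S2.eq_one_of_smul_eq ((h.isCoef _).nonneg v) e.symm]
  · rw [h0 x hx, Pi.single_eq_of_ne hx]

lemma sum_coef {M : Type*} [AddCommGroup M] [Module ℝ M] {w : Realization G} {u v : Fin n}
    (huv : u ≠ v) (hw : w ∈ edge G u v) (f : Fin n → M) :
    ∑ x, coef Γ w x • f x = coef Γ w u • f u + coef Γ w v • f v :=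
  Finset.sum_eq_add u v huv (fun x _ hx => by rw [h.coef_eq_zero hw hx.1 hx.2, zero_smul])
    (by simp) (by simp)

lemma sum_coef_of_mem_cycle3 {M : Type*} [AddCommGroup M] [Module ℝ M] {i j l : Fin n}
    (hij : i ≠ j) (hjl : j ≠ l) (hli : l ≠ i) {w : Realization G} (hw : w ∈ cycle3 G i j l)
    (f : Fin n → M) :
    ∑ x, coef Γ w x • f x = coef Γ w i • f i + coef Γ w j • f j + coef Γ w l • f l := by
  rcases hw with (hw | hw) | hw
  · rw [h.sum_coef hij hw, h.coef_eq_zero hw hli hjl.symm, zero_smul, add_zero]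
  · rw [h.sum_coef hjl hw, h.coef_eq_zero hw hij hli.symm, zero_smul, zero_add]
  · rw [h.sum_coef hli hw, h.coef_eq_zero hw hjl hij.symm, zero_smul, add_zero, add_comm]

lemma coe_eq_coef_comb {w : Realization G} {u v : Fin n} (huv : u ≠ v) (hw : w ∈ edge G u v) :
    (Γ w).1 = coef Γ w u • (pos Γ u).1 + coef Γ w v • (pos Γ v).1 := by
  rw [(h.isCoef w).eq_sum, h.sum_coef huv hw fun x => (pos Γ x).1]

lemma lift_eq_sum (k : Fin n → ℝ) (w : Realization G) :
    lift Γ k w = ∑ v, coef Γ w v • shift Γ k v := by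
  simp only [lift, shift, rise, smul_add, Finset.sum_add_distrib, Finset.sum_smul, mul_smul]
  rw [← (h.isCoef w).eq_sum]

lemma lift_vertex (k : Fin n → ℝ) (v : Fin n) : lift Γ k (vertex G v) = shift Γ k v := by
  simp [h.lift_eq_sum, h.coef_vertex, Pi.single_apply]

lemma image_cycle3 {i j l : Fin n} (hij : G.Adj i j) (hjl : G.Adj j l) (hli : G.Adj l i)
    (ho : orient (pos Γ i).1 (pos Γ j).1 (pos Γ l).1 ≠ 0) : Γ '' cycle3 G i j l =
      closedTri (pos Γ i) (pos Γ j) (pos Γ l) \ openTri (pos Γ i) (pos Γ j) (pos Γ l) := by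
  rw [cycle3, image_union, image_union, closedTri_diff_openTri ho, h.edge_eq_arc _ _ hij,
    h.edge_eq_arc _ _ hjl, h.edge_eq_arc _ _ hli]

end IsShortestPathDrawing

/-! ## Triangulations and longitudes -/

lemma transGen_of_finite_between {α : Type*} {r : α → α → Prop} [IsStrictOrder α r]
    (hfin : ∀ a b, {x | r a x ∧ r x b}.Finite) {a b : α} (hab : r a b) :
    Relation.TransGen (fun a b => r a b ∧ ∀ x, r a x → ¬ r x b) a b := by
  let := partialOrderOfSO r
  have hIcc (a b : α) : (Icc a b).Finite :=
    ((((hfin a b).insert a).insert b)).subset fun x hx => by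
      rcases hx.1.eq_or_lt with rfl | ha
      · simp
      rcases hx.2.eq_or_lt with rfl | hb
      · simp
      exact Or.inr (Or.inr ⟨ha, hb⟩)
  let := LocallyFiniteOrder.ofFiniteIcc hIcc
  exact transGen_covBy_of_lt hab

namespace IsTriangulation

variable (h : IsTriangulation Γ)
include h

lemma isShortestPathDrawing : IsShortestPathDrawing Γ :=
  h.toIsShortestPathEmbedding.toIsShortestPathDrawing

lemma orient_axis_ne {u v : Fin n} (huv : u ≠ v) : orient axis (pos Γ u).1 (pos Γ v).1 ≠ 0 :=
  h.generic_poles u v huv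

lemma nontrivial : Nontrivial (Fin n) := by
  by_contra hn
  rw [not_nontrivial_iff_subsingleton] at hn
  have hsub (w w' : Realization G) : w = w' := by
    obtain ⟨u, v, -, hw⟩ := exists_mem_edge w
    obtain ⟨u', v', -, hw'⟩ := exists_mem_edge w'
    obtain rfl := Subsingleton.elim u v
    obtain rfl := Subsingleton.elim u' v'
    rw [eq_vertex_of_mem_edge_self hw, eq_vertex_of_mem_edge_self hw', Subsingleton.elim u u']
  obtain ⟨P, hP⟩ : ∃ P, P ∉ range Γ := by
    by_contra! hc
    obtain ⟨w, hw⟩ := hc northPole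
    obtain ⟨w', hw'⟩ := hc southPole
    exact northPole_ne_southPole (hw ▸ hw' ▸ congrArg Γ (hsub w w'))
  obtain ⟨i, j, -, hij, -⟩ := h.faces _ ⟨P, hP, rfl⟩
  exact hij.ne (Subsingleton.elim i j)

lemma offAxis_pos (v : Fin n) : OffAxis (pos Γ v).1 := by
  have := h.nontrivial
  obtain ⟨u, hu⟩ := exists_ne v
  exact offAxis_of_orient_axis_ne_zero (h.orient_axis_ne hu.symm)

lemma coef_eq {u v : Fin n} (huv : u ≠ v) {w : Realization G} (hw : w ∈ edge G u v) :
    coef Γ w u = orient axis (Γ w).1 (pos Γ v).1 / orient axis (pos Γ u).1 (pos Γ v).1 := by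
  rw [eq_div_iff (h.orient_axis_ne huv), h.isShortestPathDrawing.coe_eq_coef_comb huv hw]
  simp [orient_add_mid, orient_smul_mid]

lemma continuousOn_coef {u v : Fin n} (huv : u ≠ v) :
    ContinuousOn (fun w => coef Γ w u) (edge G u v) := by
  refine ContinuousOn.congr (Continuous.continuousOn ?_) fun w hw => h.coef_eq huv hw
  exact (continuous_orient continuous_const (continuous_subtype_val.comp h.continuous)
    continuous_const).div_const _

lemma continuous_coef (x : Fin n) : Continuous fun w => coef Γ w x := by
  let ι := {p : Fin n × Fin n // p.1 = p.2 ∨ G.Adj p.1 p.2}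
  refine (locallyFinite_of_finite fun p : ι => edge G p.1.1 p.1.2).continuous ?_
    (fun p => isClosed_edge _ _) ?_
  · refine iUnion_eq_univ_iff.2 fun w => ?_
    obtain ⟨u, v, huv, hw⟩ := exists_mem_edge w
    exact ⟨⟨(u, v), huv⟩, hw⟩
  · rintro ⟨⟨u, v⟩, huv⟩
    change ContinuousOn (fun w => coef Γ w x) (edge G u v)
    obtain rfl | huv : u = v ∨ G.Adj u v := huv
    · refine Set.Subsingleton.continuousOn (fun w hw w' hw' => ?_) _
      rw [eq_vertex_of_mem_edge_self hw, eq_vertex_of_mem_edge_self hw']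
    by_cases hu : x = u
    · subst hu
      exact h.continuousOn_coef huv.ne
    by_cases hv : x = v
    · subst hv
      rw [edge_comm]
      exact h.continuousOn_coef huv.ne'
    · exact continuousOn_const.congr fun w hw => h.isShortestPathDrawing.coef_eq_zero hw hu hv

lemma continuous_rise (k : Fin n → ℝ) : Continuous (rise Γ k) :=
  continuous_finsetSum _ fun v _ => (h.continuous_coef v).mul continuous_const

lemma offAxis (w : Realization G) : OffAxis (Γ w).1 := by
  obtain ⟨u, v, huv, hw⟩ := exists_mem_edge w
  rcases huv with rfl | huv
  · exact eq_vertex_of_mem_edge_self hw ▸ h.offAxis_pos u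
  by_contra hc
  have hu := h.coef_eq huv.ne hw
  have hv := h.coef_eq huv.ne' (by rwa [edge_comm])
  simp only [OffAxis, not_or, not_not] at hc
  simp only [orient_axis, hc.1, hc.2, zero_mul, sub_zero, zero_div] at hu hv
  exact (Γ w).coe_ne_zero (by simp [h.isShortestPathDrawing.coe_eq_coef_comb huv.ne hw, hu, hv])

lemma isPole_notMem_range {P : S2} (hP : IsPole P) : P ∉ range Γ := by
  rintro ⟨w, rfl⟩
  exact isPole_iff_not_offAxis.1 hP (h.offAxis w)

lemma offAxis_lift (k : Fin n → ℝ) (w : Realization G) : OffAxis (lift Γ k w) :=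
  (h.offAxis w).add_axis _

lemma lift_ne_zero (k : Fin n → ℝ) (w : Realization G) : lift Γ k w ≠ 0 :=
  (h.offAxis_lift k w).ne_zero

lemma isStrictOrder_above :
    IsStrictOrder (Realization G) fun w w' => Above axis (Γ w).1 (Γ w').1 where
  irrefl w := not_above_self (h.offAxis w)
  trans _ _ _ := Above.trans

lemma above_or_eq_or_above {w w' : Realization G} (hs : SameHalfPlane axis (Γ w).1 (Γ w').1) :
    Above axis (Γ w).1 (Γ w').1 ∨ w = w' ∨ Above axis (Γ w').1 (Γ w).1 := by
  refine hs.trichotomy.imp_right (Or.imp_left ?_)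
  rintro ⟨s, hs, e⟩
  exact h.injective (S2.eq_of_smul_eq hs.le e).symm

lemma eq_of_mem_edge_of_sameHalfPlane {u v : Fin n} (huv : u ≠ v) {w w' : Realization G}
    (hw : w ∈ edge G u v) (hw' : w' ∈ edge G u v)
    (hs : SameHalfPlane axis (Γ w).1 (Γ w').1) : w = w' := by
  obtain ⟨ρ, δ, hρ, e⟩ := hs
  have coplanar {x : Realization G} (hx : x ∈ edge G u v) :
      orient (Γ x).1 (pos Γ u).1 (pos Γ v).1 = 0 := by
    simp [h.isShortestPathDrawing.coe_eq_coef_comb huv hx, orient_add_left, orient_smul_left]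
  have ho := congrArg (fun x => orient x (pos Γ u).1 (pos Γ v).1) e
  simp only [orient_smul_left, orient_add_left, coplanar hw, coplanar hw', mul_zero,
    zero_add] at ho
  obtain rfl : δ = 0 := by simpa [h.orient_axis_ne huv] using ho.symm
  exact (h.injective (S2.eq_of_smul_eq hρ.le (by simpa using e))).symm

lemma finite_sameHalfPlane (a : E3) : {w | SameHalfPlane axis a (Γ w).1}.Finite := by
  choose u v huv hw using exists_mem_edge (G := G)
  refine Set.Finite.of_finite_image (f := fun w => (u w, v w)) (toFinite _) ?_
  intro w hs w' hs' e
  obtain ⟨eu, ev⟩ : u w = u w' ∧ v w = v w' := Prod.ext_iff.1 e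
  have hw' : w' ∈ edge G (u w) (v w) := eu ▸ ev ▸ hw w'
  rcases huv w with e | e
  · have hw := hw w
    rw [← e] at hw hw'
    rw [eq_vertex_of_mem_edge_self hw, eq_vertex_of_mem_edge_self hw']
  · exact h.eq_of_mem_edge_of_sameHalfPlane e.ne (hw w) hw'
      ((SameHalfPlane.symm hs).trans hs')

end IsTriangulation

/-! ## Faces -/

namespace IsFace

variable {U : Set S2} (hU : IsFace Γ U)
include hU

lemma subset : U ⊆ (range Γ)ᶜ := by
  obtain ⟨x, -, rfl⟩ := hU
  exact connectedComponentIn_subset _ _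

lemma isPreconnected : IsPreconnected U := by
  obtain ⟨x, -, rfl⟩ := hU
  exact isPreconnected_connectedComponentIn

lemma nonempty : U.Nonempty := by
  obtain ⟨x, hx, rfl⟩ := hU
  exact ⟨x, mem_connectedComponentIn hx⟩

lemma mem_frontier_of_mem_closure {w : Realization G} (hw : Γ w ∈ closure U) :
    Γ w ∈ frontier U :=
  ⟨hw, fun hi => hU.subset (interior_subset hi) (mem_range_self w)⟩

end IsFace

lemma isFace_of_frontier_subset {U : Set S2} (hU : IsPreconnected U) (hne : U.Nonempty)
    (hd : U ⊆ (range Γ)ᶜ) (hf : frontier U ⊆ range Γ) : IsFace Γ U := by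
  obtain ⟨x, hx⟩ := hne
  refine ⟨x, hd hx, (hU.subset_connectedComponentIn hx hd).antisymm ?_⟩
  refine subset_of_disjoint_frontier isPreconnected_connectedComponentIn ?_
    ⟨x, mem_connectedComponentIn (hd hx), hx⟩
  exact (disjoint_compl_left.mono_right hf).mono_left (connectedComponentIn_subset _ _)

lemma BoundedBy.frontier_eq {U : Set S2} {i j l : Fin n} (hb : BoundedBy Γ U i j l) :
    frontier U = Γ '' cycle3 G i j l := by
  rw [hb.2.2.2, cycle3, image_union, image_union]

lemma not_both_poles_mem {a b c : S2} (ho : orient a.1 b.1 c.1 ≠ 0)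
    (hN : northPole ∈ openTri a b c) : southPole ∉ closedTri a b c := fun hS =>
  zero_notMem_openCone ho <| by
    simpa [coe_northPole, coe_southPole] using add_mem_openCone hN hS

namespace IsTriangulation

variable (h : IsTriangulation Γ)
include h

section BoundedBy

variable {U : Set S2} {i j l : Fin n} (hb : BoundedBy Γ U i j l)
include hb

lemma orient_ne : orient (pos Γ i).1 (pos Γ j).1 (pos Γ l).1 ≠ 0 :=
  h.generic i j l hb.1.ne hb.2.1.ne hb.2.2.1.ne'

lemma frontier_eq : frontier U =
    closedTri (pos Γ i) (pos Γ j) (pos Γ l) \ openTri (pos Γ i) (pos Γ j) (pos Γ l) := by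
  rw [hb.frontier_eq,
    h.isShortestPathDrawing.image_cycle3 hb.1 hb.2.1 hb.2.2.1 (h.orient_ne hb)]

lemma eq_openTri_or_eq_compl (hU : IsFace Γ U) :
    U = openTri (pos Γ i) (pos Γ j) (pos Γ l) ∨
      U = (closedTri (pos Γ i) (pos Γ j) (pos Γ l))ᶜ := by
  refine eq_openTri_or_eq_compl_closedTri (h.orient_ne hb) hU.isPreconnected hU.nonempty
    (h.frontier_eq hb) (disjoint_compl_left.mono hU.subset ?_)
  exact hb.frontier_eq ▸ image_subset_range _ _

lemma pole_mem_openTri {P : S2} (hP : IsPole P)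
    (hm : P ∈ closedTri (pos Γ i) (pos Γ j) (pos Γ l)) :
    P ∈ openTri (pos Γ i) (pos Γ j) (pos Γ l) := by
  by_contra hc
  have hPf : P ∈ frontier U := h.frontier_eq hb ▸ ⟨hm, hc⟩
  exact h.isPole_notMem_range hP (image_subset_range _ _ (hb.frontier_eq ▸ hPf))

lemma eq_openTri_of_isNonPolar (hU : IsFace Γ U) (hp : IsNonPolar U) :
    U = openTri (pos Γ i) (pos Γ j) (pos Γ l) := by
  refine (h.eq_openTri_or_eq_compl hb hU).resolve_right ?_
  rintro rfl
  have hN := h.pole_mem_openTri hb (.inl rfl) (notMem_compl_iff.1 hp.1)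
  exact not_both_poles_mem (h.orient_ne hb) hN (notMem_compl_iff.1 hp.2)

lemma pole_notMem_closedTri (hU : IsFace Γ U) (hp : IsNonPolar U) {P : S2} (hP : IsPole P) :
    P ∉ closedTri (pos Γ i) (pos Γ j) (pos Γ l) := fun hc => by
  have hPU : P ∈ U := h.eq_openTri_of_isNonPolar hb hU hp ▸ h.pole_mem_openTri hb hP hc
  rcases hP with rfl | rfl
  exacts [hp.1 hPU, hp.2 hPU]

end BoundedBy

lemma exists_isFace_between {w w' : Realization G} (hw : Above axis (Γ w).1 (Γ w').1)
    (hc : ∀ x, Above axis (Γ w).1 (Γ x).1 → ¬ Above axis (Γ x).1 (Γ w').1) :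
    ∃ U, IsFace Γ U ∧ Γ w ∈ closure U ∧ Γ w' ∈ closure U ∧
      ∃ x ∈ U, Above axis (Γ w).1 x.1 ∧ Above axis x.1 (Γ w').1 := by
  obtain ⟨ρ, δ, hρ, hδ, e⟩ := hw
  let f : ℝ → S2 := fun s => radial ((Γ w).1 + s • axis)
  have h0 (s : ℝ) : (Γ w).1 + s • axis ≠ 0 := ((h.offAxis w).add_axis s).ne_zero
  have hf : Continuous f := continuous_radial (by fun_prop) h0
  have hf0 : f 0 = Γ w := by simp [f, radial_self]
  have hfδ : f δ = Γ w' := radial_eq_of_smul hρ e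
  have hwf {s : ℝ} (hs : s ∈ Ioo 0 δ) : Above axis (Γ w).1 (f s).1 := by
    rw [← radial_self (Γ w), above_radial_radial_iff (Γ w).coe_ne_zero (h0 s)]
    exact ⟨1, s, one_pos, hs.1, one_smul _ _⟩
  have hfw' {s : ℝ} (hs : s ∈ Ioo 0 δ) : Above axis (f s).1 (Γ w').1 := by
    rw [← radial_self (Γ w'), above_radial_radial_iff (h0 s) (Γ w').coe_ne_zero]
    exact ⟨ρ, δ - s, hρ, sub_pos.2 hs.2, by rw [e]; module⟩
  have hd : f '' Ioo 0 δ ⊆ (range Γ)ᶜ := by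
    rintro _ ⟨s, hs, rfl⟩ ⟨x, hx⟩
    exact hc x (hx ▸ hwf hs) (hx ▸ hfw' hs)
  have hm : δ / 2 ∈ Ioo 0 δ := ⟨by linarith, by linarith⟩
  have hU := (isPreconnected_Ioo.image f hf.continuousOn).subset_connectedComponentIn
    (mem_image_of_mem f hm) hd
  have hcl {s : ℝ} (hs : s ∈ Icc 0 δ) : f s ∈ closure (f '' Ioo 0 δ) :=
    image_closure_subset_closure_image hf (mem_image_of_mem f ((closure_Ioo hδ.ne).symm ▸ hs))
  refine ⟨_, ⟨f (δ / 2), hd (mem_image_of_mem f hm), rfl⟩, closure_mono hU ?_,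
    closure_mono hU ?_, _, hU (mem_image_of_mem f hm), hwf hm, hfw' hm⟩
  · exact hf0 ▸ hcl (left_mem_Icc.2 hδ.le)
  · exact hfδ ▸ hcl (right_mem_Icc.2 hδ.le)

lemma transGen_consecutive {w w' : Realization G} (hw : Above axis (Γ w).1 (Γ w').1) :
    Relation.TransGen (fun w w' => Above axis (Γ w).1 (Γ w').1 ∧
      ∀ x, Above axis (Γ w).1 (Γ x).1 → ¬ Above axis (Γ x).1 (Γ w').1) w w' := by
  have := h.isStrictOrder_above
  exact transGen_of_finite_between (r := fun w w' => Above axis (Γ w).1 (Γ w').1)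
    (fun a _ => (h.finite_sameHalfPlane (Γ a).1).subset fun _ hx => hx.1.sameHalfPlane) hw

lemma exists_isNonPolar_of_consecutive {w w' : Realization G}
    (hw : Above axis (Γ w).1 (Γ w').1)
    (hc : ∀ x, Above axis (Γ w).1 (Γ x).1 → ¬ Above axis (Γ x).1 (Γ w').1) :
    ∃ U i j l, IsFace Γ U ∧ BoundedBy Γ U i j l ∧ IsNonPolar U ∧
      w ∈ cycle3 G i j l ∧ w' ∈ cycle3 G i j l := by
  obtain ⟨U, hU, hwU, hwU', x, hxU, hwx, hxw'⟩ := h.exists_isFace_between hw hc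
  obtain ⟨i, j, l, hb⟩ := h.faces U hU
  have hwf := hU.mem_frontier_of_mem_closure hwU
  have hwf' := hU.mem_frontier_of_mem_closure hwU'
  have hcyc {y : Realization G} (hy : Γ y ∈ frontier U) : y ∈ cycle3 G i j l :=
    h.injective.mem_set_image.1 (hb.frontier_eq ▸ hy)
  refine ⟨U, i, j, l, hU, hb, ?_, hcyc hwf, hcyc hwf'⟩
  rw [h.frontier_eq hb] at hwf hwf'
  have hUt : U = openTri (pos Γ i) (pos Γ j) (pos Γ l) := by
    refine (h.eq_openTri_or_eq_compl hb hU).resolve_right ?_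
    rintro rfl
    exact hxU (mem_closedCone_of_above hxw' hwx hwf'.1 hwf.1)
  rw [hUt]
  exact ⟨notMem_openCone_of_above hw hwf.1 hwf'.2,
    notMem_openCone_of_above (above_neg_iff.2 hw) hwf'.1 hwf.2⟩

end IsTriangulation

/-! ## Admissible shifts -/

/-- The translations by `k v` along the axis preserve the orientations of all non-polar faces. -/
def IsAdmissible (Γ : Realization G → S2) (k : Fin n → ℝ) : Prop :=
  ∀ U i j l, IsFace Γ U → BoundedBy Γ U i j l → IsNonPolar U →
    0 < orient (shift Γ k i) (shift Γ k j) (shift Γ k l) /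
      orient (pos Γ i).1 (pos Γ j).1 (pos Γ l).1

/-- Every point of `G` lies on the same longitude in `Γ'` as in `Γ`, and the points on each
longitude occur in the same order from south to north. -/
structure SameLongitudeOrder (Γ Γ' : Realization G → S2) : Prop where
  sameHalfPlane : ∀ w, SameHalfPlane axis (Γ w).1 (Γ' w).1
  above : ∀ {w w'}, Above axis (Γ w).1 (Γ w').1 → Above axis (Γ' w).1 (Γ' w').1

/-- The drawing obtained from `Γ` by moving every vertex `v` along its longitude to the projection
of its translate by `k v` along the axis. -/
noncomputable def shiftDrawing (Γ : Realization G → S2) (k : Fin n → ℝ) (w : Realization G) : S2 :=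
  radial (lift Γ k w)

lemma shiftDrawing_zero : shiftDrawing Γ 0 = Γ := by
  funext w
  simp [shiftDrawing, lift, rise, radial_self]

lemma rise_smul (k : Fin n → ℝ) (t : ℝ) (w : Realization G) :
    rise Γ (t • k) w = t * rise Γ k w := by
  simp only [rise, Pi.smul_apply, smul_eq_mul, Finset.mul_sum, mul_left_comm]

namespace IsShortestPathDrawing

variable (h : IsShortestPathDrawing Γ) (k : Fin n → ℝ)
include h

lemma pos_shiftDrawing (v : Fin n) : pos (shiftDrawing Γ k) v = radial (shift Γ k v) := by
  rw [pos, shiftDrawing, h.lift_vertex]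

lemma lift_eq_coef_comb {w : Realization G} {u v : Fin n} (huv : u ≠ v) (hw : w ∈ edge G u v) :
    lift Γ k w = coef Γ w u • shift Γ k u + coef Γ w v • shift Γ k v := by
  rw [h.lift_eq_sum, h.sum_coef huv hw]

end IsShortestPathDrawing

namespace IsTriangulation

variable (h : IsTriangulation Γ)
include h

section Shift

variable (k : Fin n → ℝ)

lemma shift_ne_zero (v : Fin n) : shift Γ k v ≠ 0 := ((h.offAxis_pos v).add_axis _).ne_zero

lemma sameHalfPlane_shiftDrawing (w : Realization G) :
    SameHalfPlane axis (Γ w).1 (shiftDrawing Γ k w).1 :=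
  (sameHalfPlane_lift k w).trans (sameHalfPlane_radial axis (h.lift_ne_zero k w))

lemma sameLongitude_shiftDrawing (w : Realization G) :
    SameLongitude (Γ w) (shiftDrawing Γ k w) :=
  (h.sameHalfPlane_shiftDrawing k w).sameLongitude (h.offAxis w)

lemma continuous_shiftDrawing_smul :
    Continuous fun p : ℝ × Realization G => shiftDrawing Γ (p.1 • k) p.2 := by
  refine continuous_radial ?_ fun p => h.lift_ne_zero _ p.2
  simp only [lift, rise_smul]
  exact (continuous_subtype_val.comp (h.continuous.comp continuous_snd)).add
    ((continuous_fst.mul ((h.continuous_rise k).comp continuous_snd)).smul continuous_const)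

lemma continuous_shiftDrawing : Continuous (shiftDrawing Γ k) := by
  simpa [Function.comp_def] using
    (h.continuous_shiftDrawing_smul k).comp (Continuous.prodMk_right (1 : ℝ))

lemma exists_mem_edge_coef_eq {u v : Fin n} (huv : G.Adj u v) {s t : ℝ} (hs : 0 ≤ s) (ht : 0 ≤ t)
    (hst : s ≠ 0 ∨ t ≠ 0) :
    ∃ w ∈ edge G u v, ∃ r : ℝ, 0 < r ∧ coef Γ w u = r * s ∧ coef Γ w v = r * t := by
  have hu : orient axis (s • (pos Γ u).1 + t • (pos Γ v).1) (pos Γ v).1 =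
      s * orient axis (pos Γ u).1 (pos Γ v).1 := by simp [orient_add_mid, orient_smul_mid]
  have hv : orient axis (s • (pos Γ u).1 + t • (pos Γ v).1) (pos Γ u).1 =
      t * orient axis (pos Γ v).1 (pos Γ u).1 := by simp [orient_add_mid, orient_smul_mid]
  have h0 : s • (pos Γ u).1 + t • (pos Γ v).1 ≠ 0 := by
    intro h0
    rw [h0] at hu hv
    refine hst.elim (fun hs => hs ?_) fun ht => ht ?_
    · simpa [orient_axis 0, h.orient_axis_ne huv.ne] using hu.symm
    · simpa [orient_axis 0, h.orient_axis_ne huv.ne'] using hv.symm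
  obtain ⟨r, hr, er⟩ := exists_radial h0
  obtain ⟨w, hw, ew⟩ : radial (s • (pos Γ u).1 + t • (pos Γ v).1) ∈ Γ '' edge G u v := by
    rw [h.edge_eq_arc u v huv]
    exact ⟨r * s, r * t, by positivity, by positivity, by rw [er]; module⟩
  refine ⟨w, hw, r, hr, ?_, ?_⟩
  · rw [h.coef_eq huv.ne hw, div_eq_iff (h.orient_axis_ne huv.ne), ew, er, orient_smul_mid, hu,
      mul_assoc]
  · rw [h.coef_eq huv.ne' (by rwa [edge_comm]), div_eq_iff (h.orient_axis_ne huv.ne'), ew, er,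
      orient_smul_mid, hv, mul_assoc]

lemma image_edge_shiftDrawing {u v : Fin n} (huv : G.Adj u v) : shiftDrawing Γ k '' edge G u v =
    arc (pos (shiftDrawing Γ k) u) (pos (shiftDrawing Γ k) v) := by
  ext x
  rw [h.isShortestPathDrawing.pos_shiftDrawing, h.isShortestPathDrawing.pos_shiftDrawing,
    mem_arc_radial_radial_iff (h.shift_ne_zero k u) (h.shift_ne_zero k v)]
  constructor
  · rintro ⟨w, hw, rfl⟩
    obtain ⟨r, hr, e⟩ := exists_radial (h.lift_ne_zero k w)
    have hc := (h.isShortestPathDrawing.isCoef w).nonneg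
    refine ⟨r * coef Γ w u, r * coef Γ w v, mul_nonneg hr.le (hc u), mul_nonneg hr.le (hc v), ?_⟩
    rw [shiftDrawing, e, h.isShortestPathDrawing.lift_eq_coef_comb k huv.ne hw]
    module
  · rintro ⟨s, t, hs, ht, e⟩
    have hst : s ≠ 0 ∨ t ≠ 0 := by
      by_contra! hc
      exact x.coe_ne_zero (by simp [e, hc])
    obtain ⟨w, hw, r, hr, hu, hv⟩ := h.exists_mem_edge_coef_eq huv hs ht hst
    refine ⟨w, hw, radial_eq_of_smul hr ?_⟩
    rw [h.isShortestPathDrawing.lift_eq_coef_comb k huv.ne hw, hu, hv, e]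
    module

end Shift

section SameLongitudeOrder

variable {Γ' : Realization G → S2} (ho : SameLongitudeOrder Γ Γ')
include ho

lemma offAxis_of_sameLongitudeOrder (w : Realization G) : OffAxis (Γ' w).1 :=
  (ho.sameHalfPlane w).offAxis (h.offAxis w)

lemma above_iff_above {w w' : Realization G} :
    Above axis (Γ' w).1 (Γ' w').1 ↔ Above axis (Γ w).1 (Γ w').1 := by
  refine ⟨fun ha => ?_, ho.above⟩
  have hs := ((ho.sameHalfPlane w).trans ha.sameHalfPlane).trans (ho.sameHalfPlane w').symm
  have hirr := not_above_self (h.offAxis_of_sameLongitudeOrder ho w)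
  rcases h.above_or_eq_or_above hs with hlt | rfl | hgt
  · exact hlt
  · exact (hirr ha).elim
  · exact (hirr (ha.trans (ho.above hgt))).elim

lemma injective_of_sameLongitudeOrder : Function.Injective Γ' := by
  intro w w' e
  have hs := (ho.sameHalfPlane w).trans (e ▸ (ho.sameHalfPlane w').symm)
  have hirr := not_above_self (h.offAxis_of_sameLongitudeOrder ho w)
  rcases h.above_or_eq_or_above hs with hlt | rfl | hgt
  · exact (hirr (by simpa [← e] using ho.above hlt)).elim
  · rfl
  · exact (hirr (by simpa [← e] using ho.above hgt)).elim

end SameLongitudeOrder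

variable {k : Fin n → ℝ} (hk : IsAdmissible Γ k)
include hk

lemma above_lift_of_mem_cycle3 {U : Set S2} {i j l : Fin n} (hU : IsFace Γ U)
    (hb : BoundedBy Γ U i j l) (hp : IsNonPolar U) {w w' : Realization G}
    (hw : w ∈ cycle3 G i j l) (hw' : w' ∈ cycle3 G i j l) (ha : Above axis (Γ w).1 (Γ w').1) :
    Above axis (lift Γ k w) (lift Γ k w') := by
  obtain ⟨ρ, δ, hρ, hδ, e⟩ := ha
  have hd := h.isShortestPathDrawing
  have comb {x : Realization G} (hx : x ∈ cycle3 G i j l) (f : Fin n → E3) :=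
    hd.sum_coef_of_mem_cycle3 hb.1.ne hb.2.1.ne hb.2.2.1.ne hx f
  have hδ' : (ρ * coef Γ w' i - coef Γ w i) • (pos Γ i).1 +
      (ρ * coef Γ w' j - coef Γ w j) • (pos Γ j).1 +
      (ρ * coef Γ w' l - coef Γ w l) • (pos Γ l).1 = δ • axis := by
    rw [← sub_eq_iff_eq_add', (hd.isCoef w).eq_sum, (hd.isCoef w').eq_sum,
      comb hw fun v => (pos Γ v).1, comb hw' fun v => (pos Γ v).1] at e
    rw [← e]
    module
  refine ⟨ρ, _, hρ, mul_pos hδ (hk U i j l hU hb hp), ?_⟩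
  simp only [shift]
  rw [← comb_add_axis (h.orient_ne hb) hδ', hd.lift_eq_sum, hd.lift_eq_sum, comb hw, comb hw']
  simp only [shift]
  module

lemma above_lift {w w' : Realization G} (ha : Above axis (Γ w).1 (Γ w').1) :
    Above axis (lift Γ k w) (lift Γ k w') := by
  have consecutive {w w' : Realization G} (ha : Above axis (Γ w).1 (Γ w').1)
      (hc : ∀ x, Above axis (Γ w).1 (Γ x).1 → ¬ Above axis (Γ x).1 (Γ w').1) :
      Above axis (lift Γ k w) (lift Γ k w') := by
    obtain ⟨U, i, j, l, hU, hb, hp, hw, hw'⟩ := h.exists_isNonPolar_of_consecutive ha hc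
    exact h.above_lift_of_mem_cycle3 hk hU hb hp hw hw' ha
  have hT := h.transGen_consecutive ha
  clear ha
  induction hT with
  | single hc => exact consecutive hc.1 hc.2
  | tail _ hc ih => exact ih.trans (consecutive hc.1 hc.2)

lemma sameLongitudeOrder_shiftDrawing : SameLongitudeOrder Γ (shiftDrawing Γ k) where
  sameHalfPlane := h.sameHalfPlane_shiftDrawing k
  above {w w'} ha := (above_radial_radial_iff (h.lift_ne_zero k w) (h.lift_ne_zero k w')).2
    (h.above_lift hk ha)

lemma isShortestPathEmbedding_shiftDrawing : IsShortestPathEmbedding (shiftDrawing Γ k) where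
  continuous := h.continuous_shiftDrawing k
  not_antipodal u v huv e := by
    obtain ⟨r, -, er⟩ := (h.sameHalfPlane_shiftDrawing k (vertex G u)).exists_orient_axis
      (h.sameHalfPlane_shiftDrawing k (vertex G v))
    refine h.orient_axis_ne huv.ne (er.trans ?_)
    change r * orient axis (pos (shiftDrawing Γ k) u).1 _ = 0
    rw [e, coe_neg_sphere, orient_axis]
    simp [pos, mul_comm]
  simple_edge u v _ :=
    (h.injective_of_sameLongitudeOrder (h.sameLongitudeOrder_shiftDrawing hk)).injOn
  edge_eq_arc u v huv := h.image_edge_shiftDrawing k huv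
  injective := h.injective_of_sameLongitudeOrder (h.sameLongitudeOrder_shiftDrawing hk)

end IsTriangulation

/-! ## Drawings with the same order on every longitude -/

lemma IsPole.neg {P : S2} (hP : IsPole P) : IsPole (-P) := by
  rcases hP with rfl | rfl
  exacts [.inr rfl, .inl (neg_neg _)]

lemma IsPole.eq_or_eq_neg {P Q : S2} (hP : IsPole P) (hQ : IsPole Q) : Q = P ∨ Q = -P := by
  rcases hP with rfl | rfl <;> rcases hQ with rfl | rfl <;> simp [southPole]

lemma exists_isPole_mem_closedTri {a b c a' b' c' P : S2} (ha : SameHalfPlane axis a.1 a'.1)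
    (hb : SameHalfPlane axis b.1 b'.1) (hc : SameHalfPlane axis c.1 c'.1)
    (h : orient a'.1 b'.1 c'.1 ≠ 0) (hP : IsPole P) (hm : P ∈ closedTri a b c) :
    ∃ Q, IsPole Q ∧ Q ∈ closedTri a' b' c' := by
  obtain ⟨ρ, δ, hρ, ea⟩ := ha
  obtain ⟨ρ', δ', hρ', eb⟩ := hb
  obtain ⟨ρ'', δ'', hρ'', ec⟩ := hc
  obtain ⟨s, t, u, hs, ht, hu, e⟩ := hm
  obtain ⟨μ, eP⟩ : ∃ μ : ℝ, P.1 = μ • axis := by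
    rcases hP with rfl | rfl
    exacts [⟨1, (one_smul ℝ _).symm⟩, ⟨-1, (neg_one_smul ℝ _).symm⟩]
  obtain ⟨m, em⟩ : ∃ m : ℝ, (s * ρ) • a'.1 + (t * ρ') • b'.1 + (u * ρ'') • c'.1 = m • axis := by
    refine ⟨μ + (s * δ + t * δ' + u * δ''), ?_⟩
    rw [add_smul, ← eP, e]
    simp only [mul_smul, ea, eb, ec]
    module
  have hx : m • axis ∈ closedCone a'.1 b'.1 c'.1 :=
    ⟨s * ρ, t * ρ', u * ρ'', by positivity, by positivity, by positivity, em.symm⟩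
  rcases lt_trichotomy m 0 with hm | rfl | hm
  · refine ⟨southPole, .inr rfl, ?_⟩
    simpa [closedTri, coe_southPole, smul_smul, hm.ne] using
      (closedCone a'.1 b'.1 c'.1).smul_mem (neg_pos.2 (inv_lt_zero.2 hm)) hx
  · have hs := orient_comb_left (a := a'.1) (b := b'.1) (c := c'.1) (s * ρ) (t * ρ') (u * ρ'')
    have ht := orient_comb_mid (a := a'.1) (b := b'.1) (c := c'.1) (s * ρ) (t * ρ') (u * ρ'')
    have hu := orient_comb_right (a := a'.1) (b := b'.1) (c := c'.1) (s * ρ) (t * ρ') (u * ρ'')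
    rw [em, orient_smul_left, zero_mul, zero_eq_mul, or_iff_left h, mul_eq_zero] at hs ht hu
    exact (P.coe_ne_zero (by simp [e, hs.resolve_right hρ.ne', ht.resolve_right hρ'.ne',
      hu.resolve_right hρ''.ne'])).elim
  · refine ⟨northPole, .inl rfl, ?_⟩
    simpa [closedTri, coe_northPole, smul_smul, hm.ne'] using
      (closedCone a'.1 b'.1 c'.1).smul_mem (inv_pos.2 hm) hx

lemma exists_above_of_frontier_eq {S : Set S2} {C : Set (Realization G)} (hf : frontier S = Γ '' C)
    {P x : S2} (hP : IsPole P) (hx : OffAxis x.1) (hxS : x ∈ S) (hPS : P ∉ S) (hxC : x ∉ Γ '' C)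
    (hPC : P ∉ Γ '' C) : ∃ u ∈ C, Above P.1 x.1 (Γ u).1 := by
  have hxP : x ≠ -P := by
    rintro rfl
    exact isPole_iff_not_offAxis.1 hP.neg hx
  obtain ⟨z, hz, hxz⟩ := exists_above_mem_frontier hxP hxS hPS (hf ▸ hxC) (hf ▸ hPC)
  obtain ⟨u, hu, rfl⟩ := hf ▸ hz
  exact ⟨u, hu, hxz⟩

lemma exists_step_of_transGen {α : Type*} {r : α → α → Prop} {p : α → Prop} {a b : α}
    (h : Relation.TransGen r a b) (ha : p a) (hb : ¬ p b) : ∃ x y, r x y ∧ p x ∧ ¬ p y := by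
  induction h with
  | single hab => exact ⟨_, _, hab, ha, hb⟩
  | @tail c d _ hcd ih =>
    by_cases hc : p c
    exacts [⟨c, d, hcd, hc, hb⟩, ih hc]

lemma IsShortestPathDrawing.isFace_and_boundedBy (h : IsShortestPathDrawing Γ) {V : Set S2}
    {i j l : Fin n} (hij : G.Adj i j) (hjl : G.Adj j l) (hli : G.Adj l i)
    (ho : orient (pos Γ i).1 (pos Γ j).1 (pos Γ l).1 ≠ 0)
    (hV : V = openTri (pos Γ i) (pos Γ j) (pos Γ l) ∨
      V = (closedTri (pos Γ i) (pos Γ j) (pos Γ l))ᶜ)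
    (hne : V.Nonempty) (hd : ∀ w ∉ cycle3 G i j l, Γ w ∉ V) :
    IsFace Γ V ∧ BoundedBy Γ V i j l := by
  obtain ⟨hpre, hopen, hf⟩ : IsPreconnected V ∧ IsOpen V ∧ frontier V = Γ '' cycle3 G i j l := by
    rw [h.image_cycle3 hij hjl hli ho]
    rcases hV with rfl | rfl
    · exact ⟨isPreconnected_openTri ho, isOpen_openTri ho, frontier_openTri ho⟩
    · exact ⟨isPreconnected_compl_closedTri ho, (isClosed_closedTri ho).isOpen_compl,
        frontier_compl_closedTri ho⟩
  refine ⟨isFace_of_frontier_subset hpre hne ?_ (hf ▸ image_subset_range _ _), hij, hjl, hli, ?_⟩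
  · rintro _ hx ⟨w, rfl⟩
    refine hd w (fun hw => ?_) hx
    have hwf : Γ w ∈ frontier V := hf ▸ mem_image_of_mem Γ hw
    exact hwf.2 (hopen.interior_eq.symm ▸ hx)
  · rw [hf, cycle3, image_union, image_union]

lemma IsShortestPathDrawing.apply_mem_of_mem_cycle3 (h : IsShortestPathDrawing Γ) {i j l : Fin n}
    (hij : G.Adj i j) (hjl : G.Adj j l) (hli : G.Adj l i)
    (ho : orient (pos Γ i).1 (pos Γ j).1 (pos Γ l).1 ≠ 0) {w : Realization G}
    (hw : w ∈ cycle3 G i j l) : Γ w ∈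
      closedTri (pos Γ i) (pos Γ j) (pos Γ l) \ openTri (pos Γ i) (pos Γ j) (pos Γ l) :=
  h.image_cycle3 hij hjl hli ho ▸ mem_image_of_mem Γ hw

namespace IsTriangulation

variable (h : IsTriangulation Γ) {Γ' : Realization G → S2} (ho : SameLongitudeOrder Γ Γ')
include h ho

lemma above_pole_iff {P : S2} (hP : IsPole P) {w w' : Realization G} :
    Above P.1 (Γ' w).1 (Γ' w').1 ↔ Above P.1 (Γ w).1 (Γ w').1 := by
  rcases hP with rfl | rfl
  · exact h.above_iff_above ho
  · simpa only [coe_southPole, above_neg_iff] using h.above_iff_above ho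

lemma isPole_notMem_image {P : S2} (hP : IsPole P) (C : Set (Realization G)) : P ∉ Γ' '' C := by
  rintro ⟨w, -, rfl⟩
  exact isPole_iff_not_offAxis.1 hP (h.offAxis_of_sameLongitudeOrder ho w)

section BoundedBy

variable {U : Set S2} {i j l : Fin n} (hb : BoundedBy Γ U i j l)
include hb

lemma exists_pole_above {P : S2} (hP : IsPole P) (hPU : P ∈ U) (hU : IsFace Γ U)
    {w : Realization G} (hw : w ∉ cycle3 G i j l) :
    ∃ u ∈ cycle3 G i j l, Above P.1 (Γ' w).1 (Γ' u).1 := by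
  have hf : frontier Uᶜ = Γ '' cycle3 G i j l := by rw [frontier_compl, hb.frontier_eq]
  obtain ⟨u, hu, hwu⟩ := exists_above_of_frontier_eq hf hP (h.offAxis w)
    (fun hwU => hU.subset hwU (mem_range_self w)) (not_not_intro hPU)
    (fun hc => hw (h.injective.mem_set_image.1 hc))
    (fun hc => h.isPole_notMem_range hP (image_subset_range _ _ hc))
  exact ⟨u, hu, (h.above_pole_iff ho hP).2 hwu⟩

variable (hU : IsFace Γ U)
include hU

lemma isPole_notMem_closedTri_of_isNonPolar (hp : IsNonPolar U) {P : S2} (hP : IsPole P) :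
    P ∉ closedTri (pos Γ' i) (pos Γ' j) (pos Γ' l) := fun hc => by
  obtain ⟨Q, hQ, hQm⟩ := exists_isPole_mem_closedTri (ho.sameHalfPlane (vertex G i)).symm
    (ho.sameHalfPlane (vertex G j)).symm (ho.sameHalfPlane (vertex G l)).symm
    (h.orient_ne hb) hP hc
  exact h.pole_notMem_closedTri hb hU hp hQ hQm

variable (h' : IsShortestPathDrawing Γ') (ho' : orient (pos Γ' i).1 (pos Γ' j).1 (pos Γ' l).1 ≠ 0)
include ho'

lemma isPole_mem_of_isPole_mem (hm : ∀ Q, IsPole Q → Q ∉ closedTri (pos Γ' i) (pos Γ' j) (pos Γ' l))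
    {P Q : S2} (hP : IsPole P) (hPU : P ∈ U) (hQ : IsPole Q) : Q ∈ U := by
  by_contra hQU
  obtain ⟨R, hR, hRm⟩ : ∃ R, IsPole R ∧ R ∈ closedTri (pos Γ i) (pos Γ j) (pos Γ l) := by
    rcases h.eq_openTri_or_eq_compl hb hU with rfl | rfl
    exacts [⟨P, hP, openTri_subset_closedTri hPU⟩, ⟨Q, hQ, notMem_compl_iff.1 hQU⟩]
  obtain ⟨S, hS, hSm⟩ := exists_isPole_mem_closedTri (ho.sameHalfPlane (vertex G i))
    (ho.sameHalfPlane (vertex G j)) (ho.sameHalfPlane (vertex G l)) ho' hR hRm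
  exact hm S hS hSm

include h'

lemma isFace_openTri_of_isNonPolar (hp : IsNonPolar U) :
    IsFace Γ' (openTri (pos Γ' i) (pos Γ' j) (pos Γ' l)) ∧
      BoundedBy Γ' (openTri (pos Γ' i) (pos Γ' j) (pos Γ' l)) i j l := by
  refine h'.isFace_and_boundedBy hb.1 hb.2.1 hb.2.2.1 ho' (.inl rfl) (openTri_nonempty ho')
    fun w hw hwo => ?_
  have hf := (frontier_openTri ho').trans (h'.image_cycle3 hb.1 hb.2.1 hb.2.2.1 ho').symm
  have above {P : S2} (hP : IsPole P) : ∃ u ∈ cycle3 G i j l, Above P.1 (Γ w).1 (Γ u).1 := by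
    have hPo := fun hPo => h.isPole_notMem_closedTri_of_isNonPolar ho hb hU hp hP
      (openTri_subset_closedTri hPo)
    obtain ⟨u, hu, hwu⟩ := exists_above_of_frontier_eq hf hP
      (h.offAxis_of_sameLongitudeOrder ho w) hwo hPo
      (fun hc => hw ((h.injective_of_sameLongitudeOrder ho).mem_set_image.1 hc))
      (h.isPole_notMem_image ho hP _)
    exact ⟨u, hu, (h.above_pole_iff ho hP).1 hwu⟩
  obtain ⟨u, hu, hwu⟩ := above (.inl rfl)
  obtain ⟨v, hv, hwv⟩ := above (.inr rfl)
  rw [coe_southPole, above_neg_iff] at hwv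
  have closed {u : Realization G} (hu : u ∈ cycle3 G i j l) :=
    h.isShortestPathDrawing.apply_mem_of_mem_cycle3 hb.1 hb.2.1 hb.2.2.1 (h.orient_ne hb) hu
  have hwc : Γ w ∈ closedTri (pos Γ i) (pos Γ j) (pos Γ l) :=
    mem_closedCone_of_above hwu hwv (closed hu).1 (closed hv).1
  have hwU : Γ w ∈ U := by
    rw [h.eq_openTri_of_isNonPolar hb hU hp]
    by_contra hwo
    have hwf : Γ w ∈ frontier U := h.frontier_eq hb ▸ ⟨hwc, hwo⟩
    exact hw (h.injective.mem_set_image.1 (hb.frontier_eq ▸ hwf))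
  exact hU.subset hwU (mem_range_self w)

lemma isFace_openTri_of_isPole_mem {P : S2} (hP : IsPole P) (hPU : P ∈ U)
    (hPo : P ∈ openTri (pos Γ' i) (pos Γ' j) (pos Γ' l)) :
    IsFace Γ' (openTri (pos Γ' i) (pos Γ' j) (pos Γ' l)) ∧
      BoundedBy Γ' (openTri (pos Γ' i) (pos Γ' j) (pos Γ' l)) i j l := by
  refine h'.isFace_and_boundedBy hb.1 hb.2.1 hb.2.2.1 ho' (.inl rfl) ⟨P, hPo⟩ fun w hw hwo => ?_
  obtain ⟨u, hu, hwu⟩ := h.exists_pole_above ho hb hP hPU hU hw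
  have huo := (h'.apply_mem_of_mem_cycle3 hb.1 hb.2.1 hb.2.2.1 ho' hu).2
  exact notMem_openCone_of_above hwu (openTri_subset_closedTri hwo) huo hPo

lemma isFace_compl_closedTri_of_isPole_notMem {P : S2} (hP : IsPole P) (hPU : P ∈ U)
    (hPc : P ∉ closedTri (pos Γ' i) (pos Γ' j) (pos Γ' l)) :
    IsFace Γ' (closedTri (pos Γ' i) (pos Γ' j) (pos Γ' l))ᶜ ∧
      BoundedBy Γ' (closedTri (pos Γ' i) (pos Γ' j) (pos Γ' l))ᶜ i j l := by
  refine h'.isFace_and_boundedBy hb.1 hb.2.1 hb.2.2.1 ho' (.inr rfl) ⟨P, hPc⟩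
    fun w hw hwc => hwc ?_
  have closed {u : Realization G} (hu : u ∈ cycle3 G i j l) :=
    (h'.apply_mem_of_mem_cycle3 hb.1 hb.2.1 hb.2.2.1 ho' hu).1
  obtain ⟨u, hu, hwu⟩ := h.exists_pole_above ho hb hP hPU hU hw
  by_cases hnP : -P ∈ closedTri (pos Γ' i) (pos Γ' j) (pos Γ' l)
  · rw [← neg_neg P, coe_neg_sphere, above_neg_iff] at hwu
    obtain ⟨ρ, δ, hρ, hδ, e⟩ := hwu
    rw [closedTri, mem_ofPred_eq, ← (closedCone _ _ _).smul_mem_iff hρ, e]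
    exact (closedCone _ _ _).add_mem (closed hu) ((closedCone _ _ _).smul_mem hδ hnP)
  · have hm (Q : S2) (hQ : IsPole Q) : Q ∉ closedTri (pos Γ' i) (pos Γ' j) (pos Γ' l) := by
      rcases hP.eq_or_eq_neg hQ with rfl | rfl
      exacts [hPc, hnP]
    have hnPU := h.isPole_mem_of_isPole_mem ho hb hU ho' hm hP hPU hP.neg
    obtain ⟨v, hv, hwv⟩ := h.exists_pole_above ho hb hP.neg hnPU hU hw
    rw [coe_neg_sphere, above_neg_iff] at hwv
    exact mem_closedCone_of_above hwu hwv (closed hu) (closed hv)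

lemma exists_isFace_mem_of_isPole {P : S2} (hP : IsPole P) (hPU : P ∈ U) :
    ∃ V, IsFace Γ' V ∧ BoundedBy Γ' V i j l ∧ P ∈ V := by
  by_cases hPc : P ∈ closedTri (pos Γ' i) (pos Γ' j) (pos Γ' l)
  · have hPo : P ∈ openTri (pos Γ' i) (pos Γ' j) (pos Γ' l) := by
      by_contra hPo
      refine h.isPole_notMem_image ho hP (cycle3 G i j l) ?_
      exact h'.image_cycle3 hb.1 hb.2.1 hb.2.2.1 ho' ▸ ⟨hPc, hPo⟩
    obtain ⟨hV, hVb⟩ := h.isFace_openTri_of_isPole_mem ho hb hU h' ho' hP hPU hPo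
    exact ⟨_, hV, hVb, hPo⟩
  · obtain ⟨hV, hVb⟩ := h.isFace_compl_closedTri_of_isPole_notMem ho hb hU h' ho' hP hPU hPc
    exact ⟨_, hV, hVb, hPc⟩

end BoundedBy

variable (h' : IsShortestPathDrawing Γ')
  (hg : ∀ u v w, u ≠ v → v ≠ w → u ≠ w → orient (pos Γ' u).1 (pos Γ' v).1 (pos Γ' w).1 ≠ 0)
include h' hg

lemma exists_isFace_boundedBy_mem_of_isPole {P : S2} (hP : IsPole P) :
    ∃ V i j l, IsFace Γ' V ∧ BoundedBy Γ' V i j l ∧ P ∈ V := by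
  have hU : IsFace Γ (connectedComponentIn (range Γ)ᶜ P) := ⟨P, h.isPole_notMem_range hP, rfl⟩
  obtain ⟨i, j, l, hb⟩ := h.faces _ hU
  obtain ⟨V, hV⟩ := h.exists_isFace_mem_of_isPole ho hb hU h'
    (hg i j l hb.1.ne hb.2.1.ne hb.2.2.1.ne') hP
    (mem_connectedComponentIn (h.isPole_notMem_range hP))
  exact ⟨V, i, j, l, hV⟩

lemma exists_isFace_boundedBy_mem_of_not_above {P x : S2} (hP : IsPole P) (hx : OffAxis x.1)
    (hxr : x ∉ range Γ') (ha : ∀ w, ¬ Above P.1 x.1 (Γ' w).1) :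
    ∃ V i j l, IsFace Γ' V ∧ BoundedBy Γ' V i j l ∧ x ∈ V := by
  obtain ⟨V, i, j, l, hV, hVb, hPV⟩ := h.exists_isFace_boundedBy_mem_of_isPole ho h' hg hP
  refine ⟨V, i, j, l, hV, hVb, ?_⟩
  by_contra hxV
  have hf : frontier Vᶜ = Γ' '' cycle3 G i j l := by rw [frontier_compl, hVb.frontier_eq]
  obtain ⟨u, -, hu⟩ := exists_above_of_frontier_eq hf hP hx hxV (not_not_intro hPV)
    (fun hc => hxr (image_subset_range _ _ hc)) (h.isPole_notMem_image ho hP _)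
  exact ha u hu

lemma exists_isFace_boundedBy_mem_of_above {x : S2} (hxr : x ∉ range Γ') {w w' : Realization G}
    (hw : Above axis (Γ' w).1 x.1) (hw' : Above axis x.1 (Γ' w').1) :
    ∃ V i j l, IsFace Γ' V ∧ BoundedBy Γ' V i j l ∧ x ∈ V := by
  have hww' : Above axis (Γ w).1 (Γ w').1 := (h.above_iff_above ho).1 (hw.trans hw')
  have hnw' : ¬ Above axis (Γ' w').1 x.1 := fun hc =>
    not_above_self (h.offAxis_of_sameLongitudeOrder ho w') (hc.trans hw')
  obtain ⟨y, y', ⟨hyy', hc⟩, hy, hny'⟩ :=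
    exists_step_of_transGen (p := fun y => Above axis (Γ' y).1 x.1)
      (h.transGen_consecutive hww') hw hnw'
  have hy' : Above axis x.1 (Γ' y').1 := by
    rcases (hy.sameHalfPlane.symm.trans (ho.above hyy').sameHalfPlane).trichotomy with
      hlt | ⟨s, hs, e⟩ | hgt
    · exact hlt
    · exact (hxr ⟨y', S2.eq_of_smul_eq hs.le e⟩).elim
    · exact (hny' hgt).elim
  obtain ⟨U, i, j, l, hU, hb, hp, hyU, hyU'⟩ := h.exists_isNonPolar_of_consecutive hyy' hc
  have ho' := hg i j l hb.1.ne hb.2.1.ne hb.2.2.1.ne'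
  have closed {y : Realization G} (hy : y ∈ cycle3 G i j l) :=
    (h'.apply_mem_of_mem_cycle3 hb.1 hb.2.1 hb.2.2.1 ho' hy).1
  obtain ⟨hV, hVb⟩ := h.isFace_openTri_of_isNonPolar ho hb hU h' ho' hp
  refine ⟨_, i, j, l, hV, hVb, ?_⟩
  by_contra hxo
  have hxf : x ∈ closedTri (pos Γ' i) (pos Γ' j) (pos Γ' l) \ _ :=
    ⟨mem_closedCone_of_above hy' hy (closed hyU') (closed hyU), hxo⟩
  rw [← h'.image_cycle3 hb.1 hb.2.1 hb.2.2.1 ho'] at hxf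
  exact hxr (image_subset_range _ _ hxf)

lemma exists_isFace_boundedBy_mem {x : S2} (hxr : x ∉ range Γ') :
    ∃ V i j l, IsFace Γ' V ∧ BoundedBy Γ' V i j l ∧ x ∈ V := by
  by_cases hx : IsPole x
  · exact h.exists_isFace_boundedBy_mem_of_isPole ho h' hg hx
  rw [isPole_iff_not_offAxis, not_not] at hx
  by_cases hN : ∀ w, ¬ Above northPole.1 x.1 (Γ' w).1
  · exact h.exists_isFace_boundedBy_mem_of_not_above ho h' hg (.inl rfl) hx hxr hN
  by_cases hS : ∀ w, ¬ Above southPole.1 x.1 (Γ' w).1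
  · exact h.exists_isFace_boundedBy_mem_of_not_above ho h' hg (.inr rfl) hx hxr hS
  push Not at hN hS
  obtain ⟨w', hw'⟩ := hN
  obtain ⟨w, hw⟩ := hS
  rw [coe_southPole, above_neg_iff] at hw
  exact h.exists_isFace_boundedBy_mem_of_above ho h' hg hxr hw hw'

end IsTriangulation

theorem IsTriangulation.of_sameLongitudeOrder (h : IsTriangulation Γ) {Γ' : Realization G → S2}
    (h' : IsShortestPathEmbedding Γ') (ho : SameLongitudeOrder Γ Γ')
    (hg : ∀ u v w, u ≠ v → v ≠ w → u ≠ w →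
      orient (pos Γ' u).1 (pos Γ' v).1 (pos Γ' w).1 ≠ 0) : IsTriangulation Γ' where
  toIsShortestPathEmbedding := h'
  faces := by
    rintro _ ⟨x, hx, rfl⟩
    obtain ⟨V, i, j, l, ⟨y, -, rfl⟩, hb, hxV⟩ :=
      h.exists_isFace_boundedBy_mem ho h'.toIsShortestPathDrawing hg hx
    exact ⟨i, j, l, connectedComponentIn_eq hxV ▸ hb⟩
  generic := hg
  generic_poles u v huv := by
    obtain ⟨r, -, e⟩ := (ho.sameHalfPlane (vertex G u)).exists_orient_axis
      (ho.sameHalfPlane (vertex G v))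
    refine right_ne_zero_of_mul (a := r) ?_
    exact e ▸ h.orient_axis_ne huv

/-! ## Morphs preserve the rotation system -/

lemma pos_iff_pos_of_forall_ne_zero {X : Type*} [TopologicalSpace X] [PreconnectedSpace X]
    {f : X → ℝ} (hf : Continuous f) (h0 : ∀ x, f x ≠ 0) (a b : X) : 0 < f a ↔ 0 < f b := by
  have key {a b : X} (ha : 0 < f a) : 0 < f b := by
    by_contra! hb
    obtain ⟨x, hx⟩ := mem_range_of_exists_le_of_exists_ge hf ⟨b, hb⟩ ⟨a, ha.le⟩
    exact h0 x hx
  exact ⟨key, key⟩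

lemma exists_comb_eq_zero_of_orient_eq_zero {a b c : E3} (h : orient a b c = 0) :
    ∃ v : Fin 3 → ℝ, v ≠ 0 ∧ v 0 • a + v 1 • b + v 2 • c = 0 := by
  obtain ⟨v, hv, e⟩ := Matrix.exists_vecMul_eq_zero_iff.2 h
  refine ⟨v, hv, ?_⟩
  ext i
  have := congrFun e i
  fin_cases i <;> simpa [Matrix.vecMul, dotProduct, Fin.sum_univ_three] using this

lemma orient_sub_sub_ne_zero {u α β γ : E3} (hu : u ≠ 0) (hα : inner ℝ u α = 0)
    (hβ : inner ℝ u β = 0) (hγ : inner ℝ u γ = 0) (hi : AffineIndependent ℝ ![α, β, γ]) :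
    orient u (β - α) (γ - α) ≠ 0 := by
  intro h0
  obtain ⟨v, hv, e⟩ := exists_comb_eq_zero_of_orient_eq_zero h0
  have h0 : v 0 = 0 := by
    have := congrArg (inner ℝ u) e
    simpa [inner_add_right, inner_sub_right, inner_smul_right, hα, hβ, hγ, hu] using this
  have hw := hi.eq_zero_of_sum_eq_zero (s := .univ) (w := ![-v 1 - v 2, v 1, v 2])
    (by simp [Fin.sum_univ_three, add_assoc])
    (by simp only [Fin.sum_univ_three, ← e, h0]; simp; module)
  refine hv (funext fun i => ?_)
  fin_cases i
  exacts [h0, hw 1 (Finset.mem_univ _), hw 2 (Finset.mem_univ _)]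

lemma sub_inner_smul_ne_zero {u a : S2} (h : u ≠ a) (h' : u ≠ -a) :
    a.1 - inner ℝ u.1 a.1 • u.1 ≠ 0 := by
  intro h0
  have e : a.1 = inner ℝ u.1 a.1 • u.1 := sub_eq_zero.1 h0
  rcases le_total 0 (inner ℝ u.1 a.1 : ℝ) with hc | hc
  · exact h (S2.eq_of_smul_eq hc e.symm)
  · exact h' (S2.eq_of_smul_eq (neg_nonneg.2 hc) (by rw [neg_smul, ← e, coe_neg_sphere]))

lemma norm_direction {u a : S2} (h : u ≠ a) (h' : u ≠ -a) : ‖direction u a‖ = 1 :=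
  norm_smul_inv_norm (𝕜 := ℝ) (sub_inner_smul_ne_zero h h')

lemma inner_direction (u a : S2) : inner ℝ u.1 (direction u a) = 0 := by
  simp [direction, inner_smul_right, inner_sub_right]

lemma continuous_direction {X : Type*} [TopologicalSpace X] {f g : X → S2} (hf : Continuous f)
    (hg : Continuous g) (h : ∀ x, f x ≠ g x) (h' : ∀ x, f x ≠ -g x) :
    Continuous fun x => direction (f x) (g x) := by
  have hf := continuous_subtype_val.comp hf
  have hg := continuous_subtype_val.comp hg
  have hsub := hg.sub ((hf.inner (𝕜 := ℝ) hg).smul hf)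
  exact (hsub.norm.inv₀ fun x => norm_ne_zero_iff.2 (sub_inner_smul_ne_zero (h x) (h' x))).smul
    hsub

lemma sameHalfPlane_direction {u a : S2} (h : u ≠ a) (h' : u ≠ -a) :
    SameHalfPlane u.1 a.1 (direction u a) := by
  have hr := inv_pos.2 (norm_pos_iff.2 (sub_inner_smul_ne_zero h h'))
  have hs := sameHalfPlane_add_smul u.1 a.1 (-inner ℝ u.1 a.1)
  rw [neg_smul, ← sub_eq_add_neg] at hs
  exact hs.trans (sameHalfPlane_smul u.1 _ hr)

namespace IsShortestPathEmbedding

variable (h : IsShortestPathEmbedding Γ)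
include h

lemma pos_injective : Function.Injective (pos Γ) := fun u v e => by
  have hu : vertex G u ∈ edge G u u := vertex_mem_edge_iff.2 (.inl rfl)
  rw [h.injective e, vertex_mem_edge_iff, or_self_iff] at hu
  exact hu.symm

lemma eq_or_eq_of_pos_mem_arc {u v x : Fin n} (huv : G.Adj u v)
    (hx : pos Γ x ∈ arc (pos Γ u) (pos Γ v)) : x = u ∨ x = v := by
  rw [← h.edge_eq_arc u v huv] at hx
  exact vertex_mem_edge_iff.1 (h.injective.mem_set_image.1 hx)

lemma eq_of_sameHalfPlane {u a b : Fin n} (ha : G.Adj u a) (hb : G.Adj u b)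
    (hs : SameHalfPlane (pos Γ u).1 (pos Γ a).1 (pos Γ b).1) : a = b := by
  obtain ⟨ρ, δ, hρ, e⟩ := hs
  rcases le_total 0 δ with hδ | hδ
  · refine ((h.eq_or_eq_of_pos_mem_arc ha ⟨ρ⁻¹ * δ, ρ⁻¹, by positivity, by positivity, ?_⟩)
      |>.resolve_left hb.ne').symm
    rw [eq_inv_smul_iff₀ hρ.ne' |>.2 e]
    module
  · refine ((h.eq_or_eq_of_pos_mem_arc hb ⟨-δ, ρ, neg_nonneg.2 hδ, hρ.le, ?_⟩)
      |>.resolve_left ha.ne')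
    rw [e]
    module

lemma direction_ne {u a b : Fin n} (ha : G.Adj u a) (hb : G.Adj u b) (hab : a ≠ b) :
    direction (pos Γ u) (pos Γ a) ≠ direction (pos Γ u) (pos Γ b) := by
  intro e
  have hs {c : Fin n} (hc : G.Adj u c) := sameHalfPlane_direction
    (h.pos_injective.ne hc.ne) (h.not_antipodal u c hc)
  exact hab (h.eq_of_sameHalfPlane ha hb ((hs ha).trans (e ▸ (hs hb).symm)))

lemma orient_direction_ne_zero {u a b c : Fin n} (ha : G.Adj u a) (hb : G.Adj u b)
    (hc : G.Adj u c) (hab : a ≠ b) (hac : a ≠ c) (hbc : b ≠ c) :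
    orient (pos Γ u).1 (direction (pos Γ u) (pos Γ b) - direction (pos Γ u) (pos Γ a))
      (direction (pos Γ u) (pos Γ c) - direction (pos Γ u) (pos Γ a)) ≠ 0 := by
  have hn {x : Fin n} (hx : G.Adj u x) :
      direction (pos Γ u) (pos Γ x) ∈ Metric.sphere (0 : E3) 1 := by
    rw [mem_sphere_zero_iff_norm]
    exact norm_direction (h.pos_injective.ne hx.ne) (h.not_antipodal u x hx)
  exact orient_sub_sub_ne_zero (S2.coe_ne_zero _) (inner_direction _ _) (inner_direction _ _)
    (inner_direction _ _) (EuclideanGeometry.Cospherical.affineIndependent_of_mem_of_ne ⟨0, 1,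
      fun _ => id⟩ (hn ha) (hn hb) (hn hc) (h.direction_ne ha hb hab) (h.direction_ne ha hc hac)
      (h.direction_ne hb hc hbc))

end IsShortestPathEmbedding

section Morph

variable {H : unitInterval × Realization G → S2} {Γ' : Realization G → S2}

lemma IsMorph.continuous_pos (hH : IsMorph H Γ Γ') (v : Fin n) :
    Continuous fun t => pos (fun w => H (t, w)) v :=
  hH.continuous.comp (Continuous.prodMk_left _)

lemma IsMorph.pos_iff_pos (hH : IsMorph H Γ Γ') {F : (Realization G → S2) → ℝ}
    (hF : Continuous fun t => F fun w => H (t, w)) (h0 : ∀ t, F (fun w => H (t, w)) ≠ 0) :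
    0 < F Γ ↔ 0 < F Γ' := by
  simpa only [funext hH.source, funext hH.target] using!
    pos_iff_pos_of_forall_ne_zero hF h0 0 1

lemma IsMorph.isomorphic (hH : IsMorph H Γ Γ') : Isomorphic Γ Γ' := by
  intro u a b c ha hb hc
  rcases eq_or_ne a b with rfl | hab
  · simp [IsCcwAround, orient_eq]
  rcases eq_or_ne b c with rfl | hbc
  · simp [IsCcwAround]
  rcases eq_or_ne a c with rfl | hac
  · simp [IsCcwAround, orient_eq]
  have hdir {x : Fin n} (hx : G.Adj u x) := continuous_direction (hH.continuous_pos u)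
    (hH.continuous_pos x) (fun t => (hH.embedding t).pos_injective.ne hx.ne)
    (fun t => (hH.embedding t).not_antipodal u x hx)
  exact hH.pos_iff_pos (F := fun Γ => orient (pos Γ u).1
      (direction (pos Γ u) (pos Γ b) - direction (pos Γ u) (pos Γ a))
      (direction (pos Γ u) (pos Γ c) - direction (pos Γ u) (pos Γ a)))
    (continuous_orient (continuous_subtype_val.comp (hH.continuous_pos u))
      ((hdir hb).sub (hdir ha)) ((hdir hc).sub (hdir ha)))
    fun t => (hH.embedding t).orient_direction_ne_zero ha hb hc hab hac hbc

end Morph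

/-! ## Sinking a triangulation along a weak triangulation -/

/-- The translations by `k v` along the axis preserve the orientations of the non-polar faces, some
of which may become degenerate. -/
def IsWeaklyAdmissible (Γ : Realization G → S2) (k : Fin n → ℝ) : Prop :=
  ∀ U i j l, IsFace Γ U → BoundedBy Γ U i j l → IsNonPolar U →
    0 ≤ orient (shift Γ k i) (shift Γ k j) (shift Γ k l) /
      orient (pos Γ i).1 (pos Γ j).1 (pos Γ l).1

lemma IsAdmissible.isWeaklyAdmissible {k : Fin n → ℝ} (hk : IsAdmissible Γ k) :
    IsWeaklyAdmissible Γ k := fun U i j l hU hb hp => (hk U i j l hU hb hp).le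

/-- No three of the given points lie in a plane through the origin. -/
def InGeneralPosition {ι : Type*} (p : ι → E3) : Prop :=
  ∀ u v w, u ≠ v → v ≠ w → u ≠ w → orient (p u) (p v) (p w) ≠ 0

lemma InGeneralPosition.smul {ι : Type*} {p : ι → E3} (hp : InGeneralPosition p) {r : ι → ℝ}
    (hr : ∀ v, r v ≠ 0) : InGeneralPosition fun v => r v • p v := fun u v w huv hvw huw => by
  simpa only [orient_smul_left, orient_smul_mid, orient_smul_right] using
    mul_ne_zero (hr w) (mul_ne_zero (hr v) (mul_ne_zero (hr u) (hp u v w huv hvw huw)))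

lemma orient_shift (k : Fin n → ℝ) (i j l : Fin n) :
    orient (shift Γ k i) (shift Γ k j) (shift Γ k l) =
      orient (pos Γ i).1 (pos Γ j).1 (pos Γ l).1 +
        (k i * orient axis (pos Γ j).1 (pos Γ l).1 + k j * orient axis (pos Γ l).1 (pos Γ i).1 +
          k l * orient axis (pos Γ i).1 (pos Γ j).1) :=
  orient_add_axis _ _ _ _ _ _

lemma continuous_shift (v : Fin n) : Continuous fun k => shift Γ k v := by
  unfold shift
  fun_prop

lemma continuous_orient_shift (i j l : Fin n) :
    Continuous fun k => orient (shift Γ k i) (shift Γ k j) (shift Γ k l) :=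
  continuous_orient (continuous_shift i) (continuous_shift j) (continuous_shift l)

lemma isOpen_isAdmissible (Γ : Realization G → S2) : IsOpen {k | IsAdmissible Γ k} := by
  refine isOpen_iff_mem_nhds.2 fun k hk => ?_
  have near (i j l : Fin n) : ∀ᶠ k' in 𝓝 k,
      (∃ U, IsFace Γ U ∧ BoundedBy Γ U i j l ∧ IsNonPolar U) →
        0 < orient (shift Γ k' i) (shift Γ k' j) (shift Γ k' l) /
          orient (pos Γ i).1 (pos Γ j).1 (pos Γ l).1 :=
    eventually_imp_distrib_left.2 fun ⟨U, hU, hb, hp⟩ =>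
      ((continuous_orient_shift i j l).div_const _).continuousAt.eventually
        (lt_mem_nhds (hk U i j l hU hb hp))
  filter_upwards [eventually_all.2 fun i => eventually_all.2 fun j => eventually_all.2 (near i j)]
    with k' hk' U i j l hU hb hp using hk' i j l ⟨U, hU, hb, hp⟩

namespace IsTriangulation

variable (h : IsTriangulation Γ)
include h

lemma orient_shift_smul_div {U : Set S2} {i j l : Fin n} (hb : BoundedBy Γ U i j l)
    (k : Fin n → ℝ) (t : ℝ) :
    orient (shift Γ (t • k) i) (shift Γ (t • k) j) (shift Γ (t • k) l) /
        orient (pos Γ i).1 (pos Γ j).1 (pos Γ l).1 =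
      (1 - t) + t * (orient (shift Γ k i) (shift Γ k j) (shift Γ k l) /
        orient (pos Γ i).1 (pos Γ j).1 (pos Γ l).1) := by
  have := h.orient_ne hb
  simp only [orient_shift, Pi.smul_apply, smul_eq_mul]
  field_simp
  ring

lemma isAdmissible_smul_of_lt_one {k : Fin n → ℝ} (hk : IsWeaklyAdmissible Γ k) {t : ℝ}
    (h0 : 0 ≤ t) (h1 : t < 1) : IsAdmissible Γ (t • k) := fun U i j l hU hb hp => by
  rw [h.orient_shift_smul_div hb]
  exact add_pos_of_pos_of_nonneg (sub_pos.2 h1) (mul_nonneg h0 (hk U i j l hU hb hp))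

lemma isAdmissible_smul {k : Fin n → ℝ} (hk : IsAdmissible Γ k) (t : unitInterval) :
    IsAdmissible Γ ((t : ℝ) • k) := by
  rcases t.2.2.eq_or_lt with h1 | h1
  · rwa [h1, one_smul]
  · exact h.isAdmissible_smul_of_lt_one hk.isWeaklyAdmissible t.2.1 h1

lemma dense_orient_shift_ne_zero {u v w : Fin n} (huv : u ≠ v) (hvw : v ≠ w) (huw : u ≠ w) :
    Dense {k | orient (shift Γ k u) (shift Γ k v) (shift Γ k w) ≠ 0} := by
  intro k
  let perturb (ε : ℝ) : Fin n → ℝ := k + ε • Pi.single u 1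
  have orient_perturb (ε : ℝ) :
      orient (shift Γ (perturb ε) u) (shift Γ (perturb ε) v) (shift Γ (perturb ε) w) =
        orient (shift Γ k u) (shift Γ k v) (shift Γ k w) +
          ε * orient axis (pos Γ v).1 (pos Γ w).1 := by
    simp only [orient_shift, perturb, Pi.add_apply, Pi.smul_apply, smul_eq_mul,
      Pi.single_eq_same, Pi.single_eq_of_ne huv.symm, Pi.single_eq_of_ne huw.symm]
    ring
  by_cases hk : orient (shift Γ k u) (shift Γ k v) (shift Γ k w) = 0
  swap
  · exact subset_closure hk
  have hlim : Tendsto perturb (𝓝[≠] 0) (𝓝 k) := by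
    have hc : Continuous perturb := by fun_prop
    simpa [perturb] using (hc.tendsto 0).mono_left nhdsWithin_le_nhds
  refine mem_closure_of_tendsto hlim ?_
  filter_upwards [self_mem_nhdsWithin] with ε hε
  rw [orient_perturb, hk, zero_add]
  exact mul_ne_zero hε (h.orient_axis_ne hvw)

lemma dense_inGeneralPosition_shift : Dense {k | InGeneralPosition (shift Γ k)} := by
  let ι := {p : Fin n × Fin n × Fin n // p.1 ≠ p.2.1 ∧ p.2.1 ≠ p.2.2 ∧ p.1 ≠ p.2.2}
  have eq_iInter : {k | InGeneralPosition (shift Γ k)} =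
      ⋂ p : ι, {k | orient (shift Γ k p.1.1) (shift Γ k p.1.2.1) (shift Γ k p.1.2.2) ≠ 0} := by
    ext k
    simp [InGeneralPosition, ι]
  rw [eq_iInter]
  exact dense_iInter_of_isOpen
    (fun p => isOpen_ne_fun (continuous_orient_shift _ _ _) continuous_const)
    fun ⟨_, huv, hvw, huw⟩ => h.dense_orient_shift_ne_zero huv hvw huw

lemma exists_isAdmissible_inGeneralPosition {k : Fin n → ℝ} (hk : IsWeaklyAdmissible Γ k)
    {O : Set (Fin n → ℝ)} (hO : IsOpen O) (hkO : k ∈ O) :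
    ∃ k' ∈ O, IsAdmissible Γ k' ∧ InGeneralPosition (shift Γ k') := by
  have hlim : Tendsto (fun t : ℝ => t • k) (𝓝[<] 1) (𝓝 k) := by
    have hc : Continuous fun t : ℝ => t • k := by fun_prop
    simpa using (hc.tendsto 1).mono_left nhdsWithin_le_nhds
  obtain ⟨t, ⟨htO, ht0⟩, ht1⟩ := (((hlim.eventually_mem (hO.mem_nhds hkO)).and
    ((eventually_ge_nhds one_pos).filter_mono nhdsWithin_le_nhds)).and
    (self_mem_nhdsWithin (s := Iio (1 : ℝ)))).exists
  obtain ⟨k', ⟨hkO', hk'⟩, hg⟩ := h.dense_inGeneralPosition_shift.inter_open_nonempty _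
    (hO.inter (isOpen_isAdmissible Γ)) ⟨t • k, htO, h.isAdmissible_smul_of_lt_one hk ht0 ht1⟩
  exact ⟨k', hkO', hk', hg⟩

lemma isMorph_shiftDrawing {k : Fin n → ℝ} (hk : IsAdmissible Γ k) :
    IsMorph (fun p : unitInterval × Realization G => shiftDrawing Γ ((p.1 : ℝ) • k) p.2) Γ
      (shiftDrawing Γ k) where
  continuous := (h.continuous_shiftDrawing_smul k).comp
    ((continuous_subtype_val.comp continuous_fst).prodMk continuous_snd)
  source w := by simp [shiftDrawing_zero]
  target w := by simp
  embedding t := h.isShortestPathEmbedding_shiftDrawing (k := (t : ℝ) • k)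
    (h.isAdmissible_smul hk t)

lemma sinkable_of_isAdmissible {k : Fin n → ℝ} (hk : IsAdmissible Γ k)
    (hs : ∀ v, shift Γ k v 2 < 0) (hg : InGeneralPosition (shift Γ k)) : Sinkable Γ := by
  choose r hr er using fun v => exists_radial (h.shift_ne_zero k v)
  replace er (v : Fin n) : (pos (shiftDrawing Γ k) v).1 = r v • shift Γ k v := by
    rw [h.isShortestPathDrawing.pos_shiftDrawing, er]
  have hgeneric : InGeneralPosition fun v => (pos (shiftDrawing Γ k) v).1 := by
    simpa only [er] using hg.smul fun v => (hr v).ne'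
  exact ⟨shiftDrawing Γ k,
    h.of_sameLongitudeOrder (h.isShortestPathEmbedding_shiftDrawing hk)
      (h.sameLongitudeOrder_shiftDrawing hk) hgeneric,
    ⟨(h.isMorph_shiftDrawing hk).isomorphic, fun v => h.sameLongitude_shiftDrawing k _⟩,
    fun v => by simpa [er] using mul_neg_of_pos_of_neg (hr v) (hs v), _,
    { toIsMorph := h.isMorph_shiftDrawing hk
      same_longitude := fun t v => h.sameLongitude_shiftDrawing _ _ }⟩

end IsTriangulation

lemma div_nonneg_of_sign_eq {x y : ℝ} (h : y ≠ 0 → SignType.sign y = SignType.sign x) :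
    0 ≤ y / x := by
  rcases lt_trichotomy y 0 with hy | rfl | hy
  · have hx : x < 0 := by rw [← sign_eq_neg_one_iff, ← h hy.ne, sign_neg hy]
    exact (div_pos_of_neg_of_neg hy hx).le
  · simp
  · have hx : 0 < x := by rw [← sign_eq_one_iff, ← h hy.ne', sign_pos hy]
    exact (div_pos hy hx).le

theorem IsTriangulation.sinkable_of_weakThetaEquivalent (h : IsTriangulation Γ)
    {Γ' : Realization G → S2} (hθ : WeakThetaEquivalent Γ Γ') (hs : IsSouthern Γ') :
    Sinkable Γ := by
  choose ρ k hρ e using fun v => (hθ.1 v).sameHalfPlane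
  replace e (v : Fin n) : shift Γ k v = ρ v • (pos Γ' v).1 := (e v).symm
  have hk : IsWeaklyAdmissible Γ k := fun U i j l hU hb hp => by
    simp only [e, orient_smul_left, orient_smul_mid, orient_smul_right, mul_div_assoc]
    have := div_nonneg_of_sign_eq (hθ.2 U i j l hU hb hp)
    have := (hρ i).le
    have := (hρ j).le
    have := (hρ l).le
    positivity
  have hsouth (v : Fin n) : shift Γ k v 2 < 0 := by
    simpa [e] using mul_neg_of_pos_of_neg (hρ v) (hs v)
  have hopen : IsOpen {k | ∀ v, shift Γ k v 2 < 0} := by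
    simp only [ofPred_forall]
    exact isOpen_iInter_of_finite fun v => isOpen_lt
      ((EuclideanSpace.proj (𝕜 := ℝ) (2 : Fin 3)).continuous.comp (continuous_shift v))
      continuous_const
  obtain ⟨k', hs', hk', hg⟩ := h.exists_isAdmissible_inGeneralPosition hk hopen hsouth
  exact h.sinkable_of_isAdmissible hk' hs' hg

/-! ## From a morph to a weak triangulation -/

lemma exists_opposite_sign {x y z : ℝ} (hx : x ≠ 0) (hy : y ≠ 0) (hz : z ≠ 0)
    (hnonneg : ¬ (0 ≤ x ∧ 0 ≤ y ∧ 0 ≤ z)) (hnonpos : ¬ (0 ≤ -x ∧ 0 ≤ -y ∧ 0 ≤ -z)) :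
    (x * y < 0 ∧ x * z < 0) ∨ (y * z < 0 ∧ y * x < 0) ∨ (z * x < 0 ∧ z * y < 0) := by
  simp only [mul_neg_iff]
  grind

lemma mem_arc_of_comb_eq_zero {a b c : S2} {x y z : ℝ} (hy : x * y < 0) (hz : x * z < 0)
    (h : x • a.1 + y • b.1 + z • c.1 = 0) : a ∈ arc b c := by
  have hx : x ≠ 0 := left_ne_zero_of_mul hy.ne
  have hxx : 0 < x * x := mul_self_pos.2 hx
  refine ⟨-(x * y) / (x * x), -(x * z) / (x * x), div_nonneg (by linarith) hxx.le,
    div_nonneg (by linarith) hxx.le, smul_right_injective E3 hx ?_⟩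
  have hr (r : ℝ) : x * (-(x * r) / (x * x)) = -r := by field_simp
  simp only [smul_add, smul_smul, hr]
  rw [eq_neg_of_add_eq_zero_left ((add_assoc _ _ _).symm.trans h)]
  module

/-- The signs of the coordinates of the axis with respect to `a`, `b`, `c` are not all equal, and
they are the coefficients of a linear relation between `a'`, `b'`, `c'`. -/
lemma mem_arc_of_orient_eq_zero {a b c a' b' c' : S2} (h : orient a.1 b.1 c.1 ≠ 0)
    (hN : northPole ∉ closedTri a b c) (hS : southPole ∉ closedTri a b c)
    (hab : orient axis a.1 b.1 ≠ 0) (hbc : orient axis b.1 c.1 ≠ 0) (hca : orient axis c.1 a.1 ≠ 0)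
    (ha : SameLongitude a a') (hb : SameLongitude b b') (hc : SameLongitude c c')
    (h' : orient a'.1 b'.1 c'.1 = 0) : a' ∈ arc b' c' ∨ b' ∈ arc c' a' ∨ c' ∈ arc a' b' := by
  set D := orient a.1 b.1 c.1
  obtain ⟨r, hr, er⟩ := hb.sameHalfPlane.symm.exists_orient_axis hc.sameHalfPlane.symm
  obtain ⟨s, hs, es⟩ := hc.sameHalfPlane.symm.exists_orient_axis ha.sameHalfPlane.symm
  obtain ⟨t, ht, et⟩ := ha.sameHalfPlane.symm.exists_orient_axis hb.sameHalfPlane.symm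
  have hrel := (orient_smul_eq a'.1 b'.1 c'.1 axis).symm
  rw [h', zero_smul, er, es, et] at hrel
  have hneg {r s x y : ℝ} (hr : 0 < r) (hs : 0 < s) (hxy : x / D * (y / D) < 0) :
      r * x * (s * y) < 0 := by
    have e : r * x * (s * y) = r * s * (D * D) * (x / D * (y / D)) := by field_simp
    rw [e]
    exact mul_neg_of_pos_of_neg (mul_pos (mul_pos hr hs) (mul_self_pos.2 h)) hxy
  change axis ∉ closedCone a.1 b.1 c.1 at hN
  change -axis ∉ closedCone a.1 b.1 c.1 at hS
  rw [mem_closedCone_iff h] at hN hS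
  simp only [orient_neg_left, neg_div] at hS
  rcases exists_opposite_sign (div_ne_zero hbc h) (div_ne_zero hca h) (div_ne_zero hab h) hN hS
    with ⟨h₁, h₂⟩ | ⟨h₁, h₂⟩ | ⟨h₁, h₂⟩
  · exact .inl (mem_arc_of_comb_eq_zero (hneg hr hs h₁) (hneg hr ht h₂) hrel)
  · exact .inr (.inl (mem_arc_of_comb_eq_zero (hneg hs ht h₁) (hneg hs hr h₂)
      (Eq.trans (by abel) hrel)))
  · exact .inr (.inr (mem_arc_of_comb_eq_zero (hneg ht hr h₁) (hneg ht hs h₂)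
      (Eq.trans (by abel) hrel)))

lemma openArc_nonempty {a b : S2} (h : a ≠ -b) : (openArc a b).Nonempty := by
  have h0 : a.1 + b.1 ≠ 0 := fun e => h (Subtype.ext (eq_neg_of_add_eq_zero_left e))
  obtain ⟨r, hr, er⟩ := exists_radial h0
  exact ⟨_, r, r, hr, hr, er.trans (smul_add r a.1 b.1)⟩

lemma openArc_subset_arc {a b : S2} : openArc a b ⊆ arc a b := fun _ ⟨s, t, hs, ht, e⟩ =>
  ⟨s, t, hs.le, ht.le, e⟩

lemma openArc_subset_closedTri {a b c : S2} : openArc a b ⊆ closedTri a b c :=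
  fun _ ⟨s, t, hs, ht, e⟩ => ⟨s, t, 0, hs.le, ht.le, le_rfl, by simpa using e⟩

lemma mem_closure_orient_pos {a b c m : S2} (h : orient a.1 b.1 c.1 ≠ 0) (hm : m ∈ arc a b) :
    m ∈ closure {x : S2 | 0 < orient a.1 b.1 x.1} := by
  refine mem_closure_of_radial (v := orient a.1 b.1 c.1 • c.1) fun ε hε h0 => ?_
  obtain ⟨s, t, -, -, e⟩ := hm
  obtain ⟨r, hr, er⟩ := exists_radial h0
  have hm0 : orient a.1 b.1 m.1 = 0 := by
    simp [e, orient_add_right, orient_smul_right]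
  rw [mem_ofPred_eq, er]
  simp only [orient_add_right, orient_smul_right, hm0, zero_add]
  exact mul_pos hr (mul_pos hε (mul_self_pos.2 h))

section CcwFace

variable {U : Set S2} {i j l : Fin n} (h : IsTriangulation Γ) (hU : IsCcwFace Γ U i j l)
include h hU

lemma IsTriangulation.eq_openTri_of_orient_pos
    (hD : 0 < orient (pos Γ i).1 (pos Γ j).1 (pos Γ l).1) :
    U = openTri (pos Γ i) (pos Γ j) (pos Γ l) := by
  refine (h.eq_openTri_or_eq_compl hU.2.1 hU.1).resolve_right fun e => ?_
  obtain ⟨m, hm⟩ := openArc_nonempty (h.not_antipodal i j hU.2.1.1)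
  have hcl : m ∈ closure (openTri (pos Γ i) (pos Γ j) (pos Γ l)) :=
    closure_openTri hD.ne' ▸ openArc_subset_closedTri hm
  obtain ⟨x, hx, hxU⟩ :=
    ((mem_closure_iff_frequently.1 hcl).and_eventually (hU.2.2.1 m hm)).exists
  have hleft : 0 < orient (pos Γ i).1 (pos Γ j).1 x.1 := by
    have := ((mem_openCone_iff hD.ne').1 hx).2.2
    rwa [orient_cycle x.1, div_pos_iff_of_pos_right hD] at this
  exact (e ▸ hxU hleft) (openTri_subset_closedTri hx)

lemma IsTriangulation.eq_compl_closedTri_of_orient_neg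
    (hD : orient (pos Γ i).1 (pos Γ j).1 (pos Γ l).1 < 0) :
    U = (closedTri (pos Γ i) (pos Γ j) (pos Γ l))ᶜ := by
  refine (h.eq_openTri_or_eq_compl hU.2.1 hU.1).resolve_left fun e => ?_
  obtain ⟨m, hm⟩ := openArc_nonempty (h.not_antipodal i j hU.2.1.1)
  obtain ⟨x, hx, hxU⟩ := ((mem_closure_iff_frequently.1 (mem_closure_orient_pos hD.ne
    (openArc_subset_arc hm))).and_eventually (hU.2.2.1 m hm)).exists
  have hxT : x ∈ openTri (pos Γ i) (pos Γ j) (pos Γ l) := e ▸ hxU hx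
  have := ((mem_openCone_iff hD.ne).1 hxT).2.2
  rw [orient_cycle x.1] at this
  exact this.not_gt (div_neg_of_pos_of_neg hx hD)

lemma IsTriangulation.orient_axis_neg_of_southPole_mem (hN : northPole ∉ U)
    (hS : southPole ∈ U) : orient axis (pos Γ j).1 (pos Γ l).1 < 0 ∧
      orient axis (pos Γ l).1 (pos Γ i).1 < 0 ∧ orient axis (pos Γ i).1 (pos Γ j).1 < 0 := by
  rcases lt_or_gt_of_ne (h.orient_ne hU.2.1) with hD | hD
  · rw [h.eq_compl_closedTri_of_orient_neg hU hD, notMem_compl_iff] at hN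
    have hN : axis ∈ openCone _ _ _ := h.pole_mem_openTri hU.2.1 (.inl rfl) hN
    simpa only [mem_openCone_iff hD.ne, div_pos_iff, hD, hD.not_gt, and_true, and_false, false_or]
      using hN
  · rw [h.eq_openTri_of_orient_pos hU hD] at hS
    change -axis ∈ openCone _ _ _ at hS
    simpa only [mem_openCone_iff hD.ne', div_pos_iff_of_pos_right hD, orient_neg_left,
      Left.neg_pos_iff] using hS

lemma IsTriangulation.orient_pos_of_isNonPolar (hp : IsNonPolar U) :
    0 < orient (pos Γ i).1 (pos Γ j).1 (pos Γ l).1 := by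
  by_contra hD
  have e := h.eq_compl_closedTri_of_orient_neg hU
    (lt_of_le_of_ne (not_lt.1 hD) (h.orient_ne hU.2.1))
  exact h.pole_notMem_closedTri hU.2.1 hU.1 hp (.inl rfl) (notMem_compl_iff.1 (e ▸ hp.1))

end CcwFace

lemma IsTriangulation.exists_openArc_preimage (h : IsTriangulation Γ) {u v : Fin n}
    (huv : G.Adj u v) {z : S2} (hz : z ∈ openArc (pos Γ u) (pos Γ v)) :
    ∃ w ∈ edge G u v, Γ w = z ∧ w.1 u ≠ 0 ∧ w.1 v ≠ 0 := by
  obtain ⟨w, hw, rfl⟩ := (h.edge_eq_arc u v huv).symm.subset (openArc_subset_arc hz)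
  obtain ⟨s, t, hs, ht, e⟩ := hz
  have hne := h.orient_axis_ne huv.ne
  refine ⟨w, hw, rfl, fun h0 => ?_, fun h0 => ?_⟩
  · rw [eq_vertex_of_apply_eq_zero hw h0] at e
    change (pos Γ v).1 = _ at e
    have := congrArg (orient axis · (pos Γ v).1) e
    simp [orient_add_mid, orient_smul_mid, hs.ne', hne] at this
  · rw [eq_vertex_of_apply_eq_zero (by rwa [edge_comm]) h0] at e
    change (pos Γ u).1 = _ at e
    have := congrArg (orient axis (pos Γ u).1 ·) e
    simp [orient_add_right, orient_smul_right, ht.ne', hne] at this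

lemma IsTriangulation.noCrossingEdges (h : IsTriangulation Γ) : NoCrossingEdges Γ := by
  rintro u v x y huv hxy ⟨z, hz, hz'⟩
  obtain ⟨w, hw, rfl, -, -⟩ := h.exists_openArc_preimage huv hz
  obtain ⟨w', -, ew, hx, hy⟩ := h.exists_openArc_preimage hxy hz'
  obtain rfl := h.injective ew
  rcases hw x hx with rfl | rfl <;> rcases hw y hy with rfl | rfl <;> simp

lemma IsTriangulation.corners_eq (h : IsTriangulation Γ) {U : Set S2} {i j l a b c : Fin n}
    (h₁ : BoundedBy Γ U i j l) (h₂ : BoundedBy Γ U a b c) :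
    ({i, j, l} : Set (Fin n)) = {a, b, c} := by
  have e : cycle3 G i j l = cycle3 G a b c :=
    h.injective.image_injective (h₁.frontier_eq.symm.trans h₂.frontier_eq)
  ext x
  simp only [mem_insert_iff, mem_singleton_iff, ← vertex_mem_cycle3_iff (G := G), e]

variable {Γ' : Realization G → S2}

lemma IsTriangulation.orient_ne_zero_of_isNonPolar (h : IsTriangulation Γ)
    (h' : IsShortestPathEmbedding Γ') (hs : ∀ v, SameLongitude (pos Γ v) (pos Γ' v))
    {U : Set S2} {i j l : Fin n} (hU : IsFace Γ U) (hb : BoundedBy Γ U i j l)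
    (hp : IsNonPolar U) : orient (pos Γ' i).1 (pos Γ' j).1 (pos Γ' l).1 ≠ 0 := by
  intro h0
  obtain ⟨hij, hjl, hli, -⟩ := id hb
  rcases mem_arc_of_orient_eq_zero (h.orient_ne hb)
    (h.pole_notMem_closedTri hb hU hp (.inl rfl)) (h.pole_notMem_closedTri hb hU hp (.inr rfl))
    (h.orient_axis_ne hij.ne) (h.orient_axis_ne hjl.ne) (h.orient_axis_ne hli.ne)
    (hs i) (hs j) (hs l) h0 with hm | hm | hm
  · exact (h'.eq_or_eq_of_pos_mem_arc hjl hm).elim hij.ne hli.ne'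
  · exact (h'.eq_or_eq_of_pos_mem_arc hli hm).elim hjl.ne hij.ne'
  · exact (h'.eq_or_eq_of_pos_mem_arc hij hm).elim hli.ne hjl.ne'

section LongitudinalMorph

variable {H : unitInterval × Realization G → S2} (h : IsTriangulation Γ)
  (hH : IsLongitudinalMorph H Γ Γ')
include h hH

lemma IsTriangulation.orient_pos_iff_of_isLongitudinalMorph {U : Set S2} {i j l : Fin n}
    (hU : IsFace Γ U) (hb : BoundedBy Γ U i j l) (hp : IsNonPolar U) :
    0 < orient (pos Γ i).1 (pos Γ j).1 (pos Γ l).1 ↔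
      0 < orient (pos Γ' i).1 (pos Γ' j).1 (pos Γ' l).1 := by
  have hc (v : Fin n) := continuous_subtype_val.comp (hH.continuous_pos v)
  exact hH.pos_iff_pos (F := fun Γ => orient (pos Γ i).1 (pos Γ j).1 (pos Γ l).1)
    (continuous_orient (hc i) (hc j) (hc l)) fun t =>
      h.orient_ne_zero_of_isNonPolar (hH.embedding t) (hH.same_longitude t) hU hb hp

lemma IsTriangulation.weakThetaEquivalent_of_isLongitudinalMorph : WeakThetaEquivalent Γ Γ' := by
  refine ⟨fun v => by simpa only [pos, hH.target] using hH.same_longitude 1 v,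
    fun U i j l hU hb hp hne => ?_⟩
  have hiff := h.orient_pos_iff_of_isLongitudinalMorph hH hU hb hp
  rcases lt_or_gt_of_ne hne with h' | h'
  · rw [sign_neg h', sign_neg]
    exact lt_of_le_of_ne (not_lt.1 fun hc => h'.not_gt (hiff.1 hc)) (h.orient_ne hb)
  · rw [sign_pos h', sign_pos (hiff.2 h')]

/-- The face around the north pole is the everted one; a face around the south pole stays upright
because its corners end up below the equator. -/
lemma IsTriangulation.noInvertedFaces_of_isLongitudinalMorph (hs : IsSouthern Γ') :
    NoInvertedFaces Γ Γ' := by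
  have hlong := (h.weakThetaEquivalent_of_isLongitudinalMorph hH).1
  obtain ⟨a, b, c, hb⟩ := h.faces _ ⟨northPole, h.isPole_notMem_range (.inl rfl), rfl⟩
  refine ⟨a, b, c, fun U i j l hU hne => ?_⟩
  have hN : northPole ∉ U := fun hN => by
    obtain ⟨⟨x, -, rfl⟩, hbU, -⟩ := hU
    rw [connectedComponentIn_eq hN] at hbU
    exact hne (h.corners_eq hbU hb)
  by_cases hS : southPole ∈ U
  · obtain ⟨hjl, hli, hij⟩ := h.orient_axis_neg_of_southPole_mem hU hN hS
    have hneg {x y : Fin n} (hxy : orient axis (pos Γ x).1 (pos Γ y).1 < 0) :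
        orient axis (pos Γ' x).1 (pos Γ' y).1 < 0 := by
      obtain ⟨r, hr, e⟩ :=
        (hlong x).sameHalfPlane.symm.exists_orient_axis (hlong y).sameHalfPlane.symm
      exact e ▸ mul_neg_of_pos_of_neg hr hxy
    rw [orient_eq_axis_expansion]
    exact add_nonneg (add_nonneg (mul_pos_of_neg_of_neg (hs i) (hneg hjl)).le
      (mul_pos_of_neg_of_neg (hs j) (hneg hli)).le) (mul_pos_of_neg_of_neg (hs l) (hneg hij)).le
  · exact ((h.orient_pos_iff_of_isLongitudinalMorph hH hU.1 hU.2.1 ⟨hN, hS⟩).1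
      (h.orient_pos_of_isNonPolar hU ⟨hN, hS⟩)).le

end LongitudinalMorph

theorem IsTriangulation.exists_weakThetaEquivalent_of_sinkable (h : IsTriangulation Γ)
    (hs : Sinkable Γ) : ∃ Γ' : Realization G → S2, IsWeakTriangulation Γ Γ' ∧
      WeakThetaEquivalent Γ Γ' ∧ IsSouthern Γ' := by
  obtain ⟨Γ', h', -, hsouth, H, hH⟩ := hs
  exact ⟨Γ', ⟨h'.isShortestPathDrawing, h.noInvertedFaces_of_isLongitudinalMorph hH hsouth,
    h'.noCrossingEdges⟩, h.weakThetaEquivalent_of_isLongitudinalMorph hH, hsouth⟩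

end SphereDrawing

theorem corollaryC {n : ℕ} (hn : 4 ≤ n) (G : SimpleGraph (Fin n))
    (Γ : SphereDrawing.Realization G → SphereDrawing.S2)
    (hΓ : SphereDrawing.IsTriangulation Γ) :
    SphereDrawing.Sinkable Γ ↔
      ∃ Γ' : SphereDrawing.Realization G → SphereDrawing.S2,
        SphereDrawing.IsWeakTriangulation Γ Γ' ∧
        SphereDrawing.WeakThetaEquivalent Γ Γ' ∧
        SphereDrawing.IsSouthern Γ' :=
  ⟨hΓ.exists_weakThetaEquivalent_of_sinkable,
    fun ⟨_, _, hθ, hs⟩ => hΓ.sinkable_of_weakThetaEquivalent hθ hs⟩
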